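/- **Setting.** Let $\hbar>0$ and let $(X,\omega)$ be a symplectic manifold of dimension $2n$ with two (possibly complex) distributions $J,K\subset TX\otimes\mathbb C$ making it a flat bi-polarized manifold: about every point there is an *adapted Darboux chart*, i.e. smooth functions $p_1,\dots,p_n,q^1,\dots,q^n$ on an open set $U$ (real-valued if $J,K$ are real, complex-valued in general) with $\omega=\sum_j dp_j\wedge dq^j$ whose coordinate fields $\partial_{p_j}$ span $J$ and $\partial_{q^j}$ span $K$ on $U$. Let $\mathrm{pr}:Y\to X$ be a prequantum circle bundle, i.e. a principal $U(1)$-bundle with a connection 1-form $\alpha$, normalized by $\alpha(\eta)=1$ on the generator $\eta$ of the action, such that $d\alpha=\mathrm{pr}^*\omega/\hbar$. For a complex vector field $\zeta$ on $X$ let $\zeta^\#$ be its $\alpha$-horizontal lift to $Y$. A prequantum wave function is a smooth $\Psi:Y\to\mathbb C$ with $\Psi(z\cdot y)=z\Psi(y)$ for $z\in U(1)$; it is $J$-polarized if $\zeta^\#[\Psi]=0$ for all $\zeta\in J$. Observables $H\in C^\infty(X,\mathbb C)$ are identified with their pullbacks to $Y$. Over an adapted chart, the lifted Poisson bivector $\pi^\#=\sum_j\bigl(\partial_{p_j}^\#\otimes\partial_{q^j}^\#-\partial_{q^j}^\#\otimes\partial_{p_j}^\#\bigr)$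 acts on functions of two variables in $Y$, the first factor on the first variable and the second factor on the second; $f\otimes g$ is the function $(y,y')\mapsto f(y)g(y')$, and $m$ is restriction to the diagonal. The formal Moyal product is $$f\bullet_{\lambda}g=\sum_{k\ge0}\frac{\lambda^k}{k!}\,m\bigl((\pi^\#)^k(f\otimes g)\bigr),$$ a formal power series in $\lambda$. The Moyal quantum product is its value at $\lambda=\hbar/\mathrm i$, $$f\bullet_\pi g=m\Bigl(\exp\bigl(\tfrac{\hbar}{\mathrm i}\pi^\#\bigr)(f\otimes g)\Bigr).$$ It is said to converge, with value the function $\Phi$ on $Y$, if about every point of $X$ there is an adapted chart over which the exponential series converges in $C^\infty$ (locally uniformly with all derivatives) on a neighbourhood of each point of the diagonal, with $\Phi$ the restriction of its sum to the diagonal. (This is automatic when the series terminates.) **Statement.** Let $H\in C^\infty(X,\mathbb C)$ be an observable and let $\Psi$ be a $J$-polarized prequantum wave function. 1. (Formal version, no convergence needed.) In every adapted chart, for every $\ell$, the following identity of formal power series in $\lambda$ holds over $U$: $$\partial_{p_\ell}^\#\bigl[H\bullet_{\lambda}\Psi\bigr]=\Bigl(1-\frac{\mathrm i\lambda}{\hbar}\Bigr)\,\bigl(\partial_{p_\ell}H\bigr)\bullet_{\lambda}\Psi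 ,$$ where the first factor on the right vanishes at $\lambda=\hbar/\mathrm i$. 2. If $H\bullet_\pi\Psi$ converges, then $H\bullet_\pi\Psi$ is again a $J$-polarized prequantum wave function (in particular smooth and $U(1)$-equivariant). -/

import Mathlib

open Filter Topology
open scoped Manifold ContDiff TensorProduct

noncomputable section

namespace FlatQuant

/-! ### Complexified tangent vectors and differentials -/

section Calculus

variable {m : ℕ} {M : Type*} [TopologicalSpace M] [ChartedSpace (EuclideanSpace ℝ (Fin m)) M]

/-- The complexified tangent space `ℂ ⊗ T_x M`. -/
abbrev CTangent (m : ℕ) {M : Type*} [TopologicalSpace M]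
    [ChartedSpace (EuclideanSpace ℝ (Fin m)) M] (x : M) : Type :=
  ℂ ⊗[ℝ] TangentSpace (𝓡 m) x

/-- The differential at `x` of a complex-valued function, on real tangent vectors. -/
def diff (m : ℕ) {M : Type*} [TopologicalSpace M] [ChartedSpace (EuclideanSpace ℝ (Fin m)) M]
    (f : M → ℂ) (x : M) : TangentSpace (𝓡 m) x →L[ℝ] ℂ :=
  mfderiv (𝓡 m) 𝓘(ℝ, ℂ) f x

/-- The differential at `x` of a complex-valued function, extended `ℂ`-linearly to complex
tangent vectors: `(a ⊗ v)[f] = a * df(v)`. -/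
def cdiff (m : ℕ) {M : Type*} [TopologicalSpace M] [ChartedSpace (EuclideanSpace ℝ (Fin m)) M]
    (f : M → ℂ) (x : M) : CTangent m x →ₗ[ℂ] ℂ :=
  (diff m f x).toLinearMap.liftBaseChange ℂ

/-- The inverse of the differential of the preferred chart at `x₀`, at the point with
coordinates `u`. -/
def chartFrame (x₀ : M) (u : EuclideanSpace ℝ (Fin m)) :
    EuclideanSpace ℝ (Fin m) →L[ℝ] TangentSpace (𝓡 m) ((extChartAt (𝓡 m) x₀).symm u) :=
  mfderiv 𝓘(ℝ, EuclideanSpace ℝ (Fin m)) (𝓡 m) (extChartAt (𝓡 m) x₀).symm u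

/-- The exterior derivative of a 1-form at `x` (in the preferred chart at `x`, whose
differential identifies `T_x M` with the model space):
`dα(v, w) = D_v α(w) - D_w α(v)`. -/
def extDeriv₁ (α : ∀ x : M, TangentSpace (𝓡 m) x →L[ℝ] ℝ) (x : M)
    (v w : TangentSpace (𝓡 m) x) : ℝ :=
  let a : EuclideanSpace ℝ (Fin m) → EuclideanSpace ℝ (Fin m) →L[ℝ] ℝ := fun u =>
    (α ((extChartAt (𝓡 m) x).symm u)).comp (chartFrame x u)
  let D := fderiv ℝ a (extChartAt (𝓡 m) x x)
  D v w - D w v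

/-- The exterior derivative of a 2-form at `x` (in the preferred chart at `x`):
`dσ(a, b, c) = D_a σ(b, c) - D_b σ(a, c) + D_c σ(a, b)`. -/
def extDeriv₂ (σ : ∀ x : M, TangentSpace (𝓡 m) x →L[ℝ] TangentSpace (𝓡 m) x →L[ℝ] ℝ) (x : M)
    (a b c : TangentSpace (𝓡 m) x) : ℝ :=
  let s : EuclideanSpace ℝ (Fin m) →
      EuclideanSpace ℝ (Fin m) →L[ℝ] EuclideanSpace ℝ (Fin m) →L[ℝ] ℝ := fun u =>
    let s₀ : EuclideanSpace ℝ (Fin m) →L[ℝ] EuclideanSpace ℝ (Fin m) →L[ℝ] ℝ :=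
      σ ((extChartAt (𝓡 m) x).symm u)
    let L : EuclideanSpace ℝ (Fin m) →L[ℝ] EuclideanSpace ℝ (Fin m) := chartFrame x u
    s₀.bilinearComp L L
  let D := fderiv ℝ s (extChartAt (𝓡 m) x x)
  D a b c - D b a c + D c a b

end Calculus

/-! ### Symplectic manifolds and prequantum circle bundles -/

/-- A symplectic form on a manifold of dimension `2n`. -/
structure SymplecticForm (n : ℕ) (X : Type*) [TopologicalSpace X]
    [ChartedSpace (EuclideanSpace ℝ (Fin (2 * n))) X] [IsManifold (𝓡 (2 * n)) ∞ X] where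
  form : ∀ x : X, TangentSpace (𝓡 (2 * n)) x →L[ℝ] TangentSpace (𝓡 (2 * n)) x →L[ℝ] ℝ
  smooth : ContMDiff (𝓡 (2 * n))
    ((𝓡 (2 * n)).prod 𝓘(ℝ, EuclideanSpace ℝ (Fin (2 * n)) →L[ℝ]
      EuclideanSpace ℝ (Fin (2 * n)) →L[ℝ] ℝ)) ∞
    (fun x => Bundle.TotalSpace.mk' (EuclideanSpace ℝ (Fin (2 * n)) →L[ℝ]
      EuclideanSpace ℝ (Fin (2 * n)) →L[ℝ] ℝ)
      (E := fun x : X => TangentSpace (𝓡 (2 * n)) x →L[ℝ] TangentSpace (𝓡 (2 * n)) x →L[ℝ] ℝ)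
      x (form x))
  alternating : ∀ x v, form x v v = 0
  nondegenerate : ∀ x v, (∀ w, form x v w = 0) → v = 0
  closed : ∀ x a b c, extDeriv₂ form x a b c = 0

/-- The infinitesimal generator `η` of a circle action: `η(y) = d/dt (exp(it) • y)` at `t = 0`. -/
def generator (m : ℕ) {Y : Type*} [TopologicalSpace Y]
    [ChartedSpace (EuclideanSpace ℝ (Fin m)) Y] [MulAction Circle Y] (y : Y) :
    TangentSpace (𝓡 m) y :=
  (mfderiv 𝓘(ℝ, ℝ) (𝓡 m) (fun t : ℝ => Circle.exp t • y) 0 : ℝ →L[ℝ] TangentSpace (𝓡 m) y) 1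

/-- Prequantum wave functions: smooth `U(1)`-equivariant complex functions on `Y`. -/
structure IsPrequantumWave (m : ℕ) {Y : Type*} [TopologicalSpace Y]
    [ChartedSpace (EuclideanSpace ℝ (Fin m)) Y] [MulAction Circle Y] (Ψ : Y → ℂ) : Prop where
  smooth : ContMDiff (𝓡 m) 𝓘(ℝ, ℂ) ∞ Ψ
  equivariant : ∀ (z : Circle) (y : Y), Ψ (z • y) = (z : ℂ) * Ψ y

section

variable {n : ℕ} {X : Type*} [TopologicalSpace X]
  [ChartedSpace (EuclideanSpace ℝ (Fin (2 * n))) X] [IsManifold (𝓡 (2 * n)) ∞ X]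

/-- A prequantum circle bundle over the symplectic manifold `(X, Ω)`: a principal `U(1)`-bundle
`proj : Y → X` (a surjective submersion whose fibres are the orbits of a free smooth circle
action, with `dim Y = dim X + 1`) with a connection 1-form `α` such that `dα = Ω / ħ`. -/
structure PrequantumBundle (ħ : ℝ) (Ω : SymplecticForm n X) (Y : Type*) [TopologicalSpace Y]
    [ChartedSpace (EuclideanSpace ℝ (Fin (2 * n + 1))) Y] [IsManifold (𝓡 (2 * n + 1)) ∞ Y]
    [MulAction Circle Y] where
  smooth_smul : ContMDiffSMul (𝓡 1) (𝓡 (2 * n + 1)) ∞ Circle Y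
  free : ∀ (z : Circle) (y : Y), z • y = y → z = 1
  proj : Y → X
  smooth_proj : ContMDiff (𝓡 (2 * n + 1)) (𝓡 (2 * n)) ∞ proj
  surjective : Function.Surjective proj
  submersion : ∀ y, Function.Surjective (mfderiv (𝓡 (2 * n + 1)) (𝓡 (2 * n)) proj y)
  fibre : ∀ y y', proj y = proj y' ↔ ∃ z : Circle, y' = z • y
  α : ∀ y : Y, TangentSpace (𝓡 (2 * n + 1)) y →L[ℝ] ℝ
  smooth_α : ContMDiff (𝓡 (2 * n + 1))
    ((𝓡 (2 * n + 1)).prod 𝓘(ℝ, EuclideanSpace ℝ (Fin (2 * n + 1)) →L[ℝ] ℝ)) ∞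
    (fun y => Bundle.TotalSpace.mk' (EuclideanSpace ℝ (Fin (2 * n + 1)) →L[ℝ] ℝ)
      (E := fun y : Y => TangentSpace (𝓡 (2 * n + 1)) y →L[ℝ] ℝ) y (α y))
  α_generator : ∀ y, α y (generator (2 * n + 1) y) = 1
  α_invariant : ∀ (z : Circle) (y : Y) (v : TangentSpace (𝓡 (2 * n + 1)) y),
    α (z • y) (mfderiv (𝓡 (2 * n + 1)) (𝓡 (2 * n + 1)) (fun y' : Y => z • y') y v) = α y v
  curvature : ∀ (y : Y) (v w : TangentSpace (𝓡 (2 * n + 1)) y),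
    extDeriv₁ α y v w = (1 / ħ) * Ω.form (proj y)
      (mfderiv (𝓡 (2 * n + 1)) (𝓡 (2 * n)) proj y v)
      (mfderiv (𝓡 (2 * n + 1)) (𝓡 (2 * n)) proj y w)

end

namespace PrequantumBundle

variable {n : ℕ} {X : Type*} [TopologicalSpace X]
  [ChartedSpace (EuclideanSpace ℝ (Fin (2 * n))) X] [IsManifold (𝓡 (2 * n)) ∞ X]
  {ħ : ℝ} {Ω : SymplecticForm n X} {Y : Type*} [TopologicalSpace Y]
  [ChartedSpace (EuclideanSpace ℝ (Fin (2 * n + 1))) Y] [IsManifold (𝓡 (2 * n + 1)) ∞ Y]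
  [MulAction Circle Y] (B : PrequantumBundle ħ Ω Y)

/-- `v ↦ (d proj (v), α(v))`. -/
def split (y : Y) : TangentSpace (𝓡 (2 * n + 1)) y →ₗ[ℝ]
    TangentSpace (𝓡 (2 * n)) (B.proj y) × ℝ :=
  (mfderiv (𝓡 (2 * n + 1)) (𝓡 (2 * n)) B.proj y).toLinearMap.prod (B.α y).toLinearMap

theorem mfderiv_proj_generator (y : Y) :
    mfderiv (𝓡 (2 * n + 1)) (𝓡 (2 * n)) B.proj y (generator (2 * n + 1) y) = 0 := by
  have := B.smooth_smul
  have h0 : ∀ y' : Y, y' = y → ∀ v : EuclideanSpace ℝ (Fin (2 * n + 1)),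
      (mfderiv (𝓡 (2 * n + 1)) (𝓡 (2 * n)) B.proj y' v : EuclideanSpace ℝ (Fin (2 * n))) =
        mfderiv (𝓡 (2 * n + 1)) (𝓡 (2 * n)) B.proj y v := by
    rintro _ rfl v
    rfl
  have hγ : MDifferentiableAt 𝓘(ℝ, ℝ) (𝓡 (2 * n + 1)) (fun t : ℝ => Circle.exp t • y) 0 := by
    have h1 : ContMDiff 𝓘(ℝ, ℝ) (𝓡 (2 * n + 1)) ∞ (fun t : ℝ => Circle.exp t • y) :=
      (ContMDiffSMul.contMDiff_smul (I := 𝓡 1) (I' := 𝓡 (2 * n + 1)) (n := ∞) (G := Circle)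
        (M := Y)).comp (contMDiff_circleExp.prodMk contMDiff_const)
    exact h1.mdifferentiableAt (by simp)
  have hp : MDifferentiableAt (𝓡 (2 * n + 1)) (𝓡 (2 * n)) B.proj
      ((fun t : ℝ => Circle.exp t • y) 0) := B.smooth_proj.mdifferentiableAt (by simp)
  have hc : B.proj ∘ (fun t : ℝ => Circle.exp t • y) = fun _ => B.proj y := by
    funext t
    exact ((B.fibre y _).2 ⟨Circle.exp t, rfl⟩).symm
  have key := mfderiv_comp (0 : ℝ) hp hγ
  rw [hc, mfderiv_const] at key
  have key2 := congrArg (fun L => L (1 : ℝ)) key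
  exact (h0 (Circle.exp 0 • y) (by simp) (generator (2 * n + 1) y)).symm.trans key2.symm

theorem split_bijective (y : Y) : Function.Bijective (B.split y) := by
  have hfin : Module.finrank ℝ (TangentSpace (𝓡 (2 * n + 1)) y) =
      Module.finrank ℝ (TangentSpace (𝓡 (2 * n)) (B.proj y) × ℝ) := by
    change Module.finrank ℝ (EuclideanSpace ℝ (Fin (2 * n + 1))) =
      Module.finrank ℝ (EuclideanSpace ℝ (Fin (2 * n)) × ℝ)
    simp
  have : FiniteDimensional ℝ (TangentSpace (𝓡 (2 * n + 1)) y) :=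
    inferInstanceAs (FiniteDimensional ℝ (EuclideanSpace ℝ (Fin (2 * n + 1))))
  have : FiniteDimensional ℝ (TangentSpace (𝓡 (2 * n)) (B.proj y)) :=
    inferInstanceAs (FiniteDimensional ℝ (EuclideanSpace ℝ (Fin (2 * n))))
  have hsurj : Function.Surjective (B.split y) := by
    rintro ⟨v, a⟩
    obtain ⟨w, hw⟩ := B.submersion y v
    refine ⟨w + (a - B.α y w) • generator (2 * n + 1) y, Prod.ext ?_ ?_⟩
    · simp [split, hw, B.mfderiv_proj_generator y]
    · simp [split, B.α_generator y]
  exact ⟨(LinearMap.injective_iff_surjective_of_finrank_eq_finrank hfin).2 hsurj, hsurj⟩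

/-- The horizontal lift at `y` of real tangent vectors: `hlift y v` is the unique tangent vector
at `y` that projects to `v` and is annihilated by `α`. -/
def hlift (y : Y) : TangentSpace (𝓡 (2 * n)) (B.proj y) →ₗ[ℝ] TangentSpace (𝓡 (2 * n + 1)) y :=
  (LinearEquiv.ofBijective (B.split y) (B.split_bijective y)).symm.toLinearMap ∘ₗ
    LinearMap.inl ℝ _ ℝ

/-- The horizontal lift at `y` of complex tangent vectors. -/
def chlift (y : Y) : CTangent (2 * n) (B.proj y) →ₗ[ℂ] CTangent (2 * n + 1) y :=
  (B.hlift y).baseChange ℂ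

/-- The derivative `ζ^#[g]` of a function `g` on `Y` along the horizontal lift of a complex
vector field `ζ` on `X`. -/
def liftDeriv (ζ : ∀ x : X, CTangent (2 * n) x) (g : Y → ℂ) : Y → ℂ := fun y =>
  cdiff (2 * n + 1) g y (B.chlift y (ζ (B.proj y)))

/-- A prequantum wave function `Ψ` is `J`-polarized if `ζ^#[Ψ] = 0` for all `ζ ∈ J`. -/
structure IsPolarized (J : ∀ x : X, Submodule ℂ (CTangent (2 * n) x)) (Ψ : Y → ℂ) : Prop where
  wave : IsPrequantumWave (2 * n + 1) Ψ
  polarized : ∀ (y : Y), ∀ ζ ∈ J (B.proj y), cdiff (2 * n + 1) Ψ y (B.chlift y ζ) = 0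

end PrequantumBundle

/-! ### Flat bi-polarized manifolds -/

section Flat

variable {n : ℕ} {X : Type*} [TopologicalSpace X]
  [ChartedSpace (EuclideanSpace ℝ (Fin (2 * n))) X] [IsManifold (𝓡 (2 * n)) ∞ X]

/-- A Darboux chart adapted to a pair `(J, K)` of (possibly complex) distributions: smooth
functions `p_j, q^j` on an open set `U` with `Ω = ∑ dp_j ∧ dq^j`, such that the coordinate vector
fields `∂_{p_j}` span `J` and `∂_{q^j}` span `K` on `U`. (The fields `∂_{p_j} = -ξ_{q^j}` and
`∂_{q^j} = ξ_{p_j}` are, up to sign, the Hamiltonian vector fields of the coordinates; they are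
recorded as the frame dual to `dp_j, dq^j`, which determines them on `U`. Their values outside
`U` play no role. For real distributions the coordinates are real-valued.) -/
structure AdaptedChart (Ω : SymplecticForm n X)
    (J K : ∀ x : X, Submodule ℂ (CTangent (2 * n) x)) where
  U : Set X
  isOpen : IsOpen U
  p : Fin n → X → ℂ
  q : Fin n → X → ℂ
  smooth_p : ∀ j, ContMDiffOn (𝓡 (2 * n)) 𝓘(ℝ, ℂ) ∞ (p j) U
  smooth_q : ∀ j, ContMDiffOn (𝓡 (2 * n)) 𝓘(ℝ, ℂ) ∞ (q j) U
  darboux : ∀ x ∈ U, ∀ v w : TangentSpace (𝓡 (2 * n)) x, (Ω.form x v w : ℂ) =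
    ∑ j, (diff (2 * n) (p j) x v * diff (2 * n) (q j) x w -
      diff (2 * n) (p j) x w * diff (2 * n) (q j) x v)
  /-- the coordinate vector field `∂_{p_j}` -/
  dp : Fin n → ∀ x : X, CTangent (2 * n) x
  /-- the coordinate vector field `∂_{q^j}` -/
  dq : Fin n → ∀ x : X, CTangent (2 * n) x
  p_dp : ∀ x ∈ U, ∀ i j, cdiff (2 * n) (p i) x (dp j x) = if i = j then 1 else 0
  q_dp : ∀ x ∈ U, ∀ i j, cdiff (2 * n) (q i) x (dp j x) = 0
  p_dq : ∀ x ∈ U, ∀ i j, cdiff (2 * n) (p i) x (dq j x) = 0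
  q_dq : ∀ x ∈ U, ∀ i j, cdiff (2 * n) (q i) x (dq j x) = if i = j then 1 else 0
  span_dp : ∀ x ∈ U, J x = Submodule.span ℂ (Set.range fun j => dp j x)
  span_dq : ∀ x ∈ U, K x = Submodule.span ℂ (Set.range fun j => dq j x)

/-- `(X, Ω, J, K)` is a flat bi-polarized manifold: about every point there is a Darboux chart
adapted to `J` and `K`. (It follows that `J` and `K` are smooth, involutive, Lagrangian and
transverse.) -/
def IsFlatBiPolarized (Ω : SymplecticForm n X)
    (J K : ∀ x : X, Submodule ℂ (CTangent (2 * n) x)) : Prop :=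
  ∀ x : X, ∃ c : AdaptedChart Ω J K, x ∈ c.U

end Flat

/-! ### The Moyal quantum product -/

/-- Convergence in `C^∞` on a neighbourhood of a point of `Y × Y`: in the chart at that point, the
functions and all their derivatives converge locally uniformly. -/
def TendstoSmoothlyNear {m : ℕ} {Y : Type*} [TopologicalSpace Y]
    [ChartedSpace (EuclideanSpace ℝ (Fin m)) Y]
    (S : ℕ → Y × Y → ℂ) (E : Y × Y → ℂ) (w : Y × Y) : Prop :=
  ∃ V : Set (EuclideanSpace ℝ (Fin m) × EuclideanSpace ℝ (Fin m)), IsOpen V ∧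
    extChartAt ((𝓡 m).prod (𝓡 m)) w w ∈ V ∧
    ∀ r : ℕ, TendstoLocallyUniformlyOn
      (fun N => iteratedFDeriv ℝ r (S N ∘ (extChartAt ((𝓡 m).prod (𝓡 m)) w).symm))
      (iteratedFDeriv ℝ r (E ∘ (extChartAt ((𝓡 m).prod (𝓡 m)) w).symm)) atTop V

/-- The operator `A ⊗ A'` on functions of two variables: `A` acts on the first variable, `A'` on
the second one. -/
def tensorOp {Y : Type*} (A A' : (Y → ℂ) → (Y → ℂ)) (Θ : Y × Y → ℂ) : Y × Y → ℂ := fun w =>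
  A (fun y₁ => A' (fun y₂ => Θ (y₁, y₂)) w.2) w.1

/-- The tensor product `f ⊗ g` of two functions, as a function of two variables. -/
def tensorFun {Y : Type*} (f g : Y → ℂ) : Y × Y → ℂ := fun w => f w.1 * g w.2

namespace PrequantumBundle

variable {n : ℕ} {X : Type*} [TopologicalSpace X]
  [ChartedSpace (EuclideanSpace ℝ (Fin (2 * n))) X] [IsManifold (𝓡 (2 * n)) ∞ X]
  {ħ : ℝ} {Ω : SymplecticForm n X} {Y : Type*} [TopologicalSpace Y]
  [ChartedSpace (EuclideanSpace ℝ (Fin (2 * n + 1))) Y] [IsManifold (𝓡 (2 * n + 1)) ∞ Y]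
  [MulAction Circle Y] (B : PrequantumBundle ħ Ω Y)
  {J K : ∀ x : X, Submodule ℂ (CTangent (2 * n) x)} (c : AdaptedChart Ω J K)

/-- The horizontal lift of the Poisson bivector over an adapted chart,
`π^# = ∑ ∂_{p_j}^# ⊗ ∂_{q^j}^# - ∂_{q^j}^# ⊗ ∂_{p_j}^#`, as an operator on functions of two
variables. -/
def poissonSharp (Θ : Y × Y → ℂ) : Y × Y → ℂ := fun w =>
  ∑ j, (tensorOp (B.liftDeriv (c.dp j)) (B.liftDeriv (c.dq j)) Θ w -
    tensorOp (B.liftDeriv (c.dq j)) (B.liftDeriv (c.dp j)) Θ w)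

/-- The formal Moyal product over an adapted chart, with formal parameter `λ`, at `y`:
`(f •_λ g)(y) = ∑ λ^k / k! * (m ∘ (π^#)^k (f ⊗ g))(y)`, `m` being the restriction to the
diagonal. -/
def formalMoyal (f g : Y → ℂ) (y : Y) : PowerSeries ℂ :=
  PowerSeries.mk fun k => (1 / (k.factorial : ℂ)) * (B.poissonSharp c)^[k] (tensorFun f g) (y, y)

/-- The partial sums `∑_{k < N} (1 / k!) (ħ / i)^k (π^#)^k (f ⊗ g)` of
`exp((ħ / i) π^#) (f ⊗ g)` over an adapted chart. -/
def expPartialSum (f g : Y → ℂ) (N : ℕ) : Y × Y → ℂ := fun w =>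
  ∑ k ∈ Finset.range N, (1 / (k.factorial : ℂ)) * ((ħ : ℂ) / Complex.I) ^ k *
    (B.poissonSharp c)^[k] (tensorFun f g) w

/-- `Φ` is the Moyal quantum product `f • g = m ∘ exp((ħ / i) π^#) (f ⊗ g)`: about every point of
`X` there is an adapted chart over which the exponential series converges in `C^∞` near the
diagonal, and `Φ` is the restriction of its sum to the diagonal. -/
def HasMoyalProduct (J K : ∀ x : X, Submodule ℂ (CTangent (2 * n) x)) (f g Φ : Y → ℂ) : Prop :=
  ∀ x : X, ∃ c : AdaptedChart Ω J K, x ∈ c.U ∧ ∃ E : Y × Y → ℂ,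
    ∀ y : Y, B.proj y ∈ c.U →
      TendstoSmoothlyNear (m := 2 * n + 1) (B.expPartialSum c f g) E (y, y) ∧ Φ y = E (y, y)

end PrequantumBundle

end FlatQuant

end

open Filter Topology
open scoped Manifold ContDiff TensorProduct

noncomputable section

namespace FlatQuant

/-! ### Dual frames and complexified functionals -/

/-! Over an adapted chart, `dp_j, dq^j, α` form a coframe of `Y` dual to the horizontal lifts of
`∂_{p_j}, ∂_{q^j}` together with the generator `η`. Expanding `dg` in this coframe and using `d(dg)
= 0` gives `[X_a, X_b] g = -dα(X_a, X_b) η[g]` for the lifted fields (`structure_equation`). Since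
`η` acts as `i k` on functions of weight `k`, the commutators are scalars on each weight space: the
lifts commute on weight 0, where `H` lives, and on weight 1, where `Ψ` lives, `[∂_{p_i}^#,
∂_{q^j}^#] = -(i/ħ) δ_ij`, while the `∂_{p_i}^#` still commute with each other.

Let `A` and `P` be `∂_{p_ℓ}^#` acting on the first and on the second variable. Then `[A, π^#] = 0`
and `[P, π^#] = -(i/ħ) A` (`rTensor_mul_poisson`, `lTensor_mul_poisson`), so `P π^(k+1) = π^(k+1) P
- (k+1)(i/ħ) π^k A`. As `P (H ⊗ Ψ) = 0` by polarization, the Leibniz rule on the diagonal,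
`∂_{p_ℓ}^# m = m (A + P)`, gives the formal identity coefficient by coefficient
(`lift_moyalCoeff_succ`, `formal_identity`).

At `λ = ħ/i` the derivative of a partial sum on the diagonal telescopes to the difference of two
consecutive partial sums for `∂_{p_ℓ} H` and `Ψ` (`lift_diagonal_tensorSum`). Those sums are the
restrictions of `A` applied to the original partial sums, so convergence in `C^∞` near the diagonal
makes them converge and their differences tend to zero. The same convergence identifies the limit of
the left side with the derivative of the product.

The operator algebra takes place in the algebraic tensor product of the weight 0 and weight 1
functions, where all operators are linear endomorphisms. `poissonSharp_iterate_of_eqOn` transfers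
the result to functions on `Y × Y`. -/

/-- Duality forces `e` to be independent, and the cardinality makes it a basis, so it suffices to
compare both sides on `e`. Spanning never has to be checked. -/
theorem eq_sum_of_dual_frame {V κ : Type*} [AddCommGroup V] [Module ℂ V] [FiniteDimensional ℂ V]
    [Fintype κ] [DecidableEq κ] (e : κ → V) (θ : κ → V →ₗ[ℂ] ℂ)
    (h : ∀ a b, θ a (e b) = if a = b then 1 else 0)
    (hcard : Fintype.card κ = Module.finrank ℂ V) (L : V →ₗ[ℂ] ℂ) (v : V) :
    L v = ∑ a, L (e a) * θ a v := by
  have hli : LinearIndependent ℂ e := by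
    rw [Fintype.linearIndependent_iff]
    intro g hg i
    have := congrArg (θ i) hg
    simpa [h] using this
  have key : L = ∑ a, L (e a) • θ a := by
    refine (basisOfLinearIndependentOfCardEqFinrank' e hli hcard).ext fun b => ?_
    simp [h]
  simpa using congrArg (fun l => l v) key

theorem tendsto_liftBaseChange {V : Type*} [AddCommGroup V] [Module ℝ V]
    {ι : Type*} {l : Filter ι} {L : ι → V →ₗ[ℝ] ℂ} {L' : V →ₗ[ℝ] ℂ}
    (h : ∀ v, Tendsto (fun i => L i v) l (𝓝 (L' v))) (ζ : ℂ ⊗[ℝ] V) :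
    Tendsto (fun i => (L i).liftBaseChange ℂ ζ) l (𝓝 (L'.liftBaseChange ℂ ζ)) := by
  induction ζ using TensorProduct.induction_on with
  | zero => simpa using tendsto_const_nhds
  | tmul a v => simpa using (h v).const_mul a
  | add x y hx hy => simpa using hx.add hy

/-- A complex bilinear form on complexified vectors vanishes if it vanishes on real vectors. -/
theorem bilinear_eq_zero_of_real {V : Type*} [AddCommGroup V] [Module ℝ V]
    (Q : (ℂ ⊗[ℝ] V) →ₗ[ℂ] (ℂ ⊗[ℝ] V) →ₗ[ℂ] ℂ) (h : ∀ v w, Q (1 ⊗ₜ v) (1 ⊗ₜ w) = 0) : Q = 0 := by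
  ext v w
  simpa using h v w

/-! ### Calculus in the preferred charts -/

section Chart

variable {m : ℕ} {M : Type*} [TopologicalSpace M] [ChartedSpace (EuclideanSpace ℝ (Fin m)) M]

theorem diff_eq_fderiv {f : M → ℂ} {x : M} (hf : MDifferentiableAt (𝓡 m) 𝓘(ℝ, ℂ) f x)
    (v : TangentSpace (𝓡 m) x) :
    diff m f x v = fderiv ℝ (f ∘ (extChartAt (𝓡 m) x).symm) (extChartAt (𝓡 m) x x) v := by
  have : diff m f x = fderiv ℝ (f ∘ (extChartAt (𝓡 m) x).symm) (extChartAt (𝓡 m) x x) := by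
    rw [diff, hf.mfderiv]
    simp [fderivWithin_univ]
    rfl
  rw [this]
  rfl

theorem contMDiffAt_of_contDiffAt_chart {f : M → ℂ} {x₀ : M}
    (hf : ContDiffAt ℝ ∞ (f ∘ (extChartAt (𝓡 m) x₀).symm) (extChartAt (𝓡 m) x₀ x₀)) :
    ContMDiffAt (𝓡 m) 𝓘(ℝ, ℂ) ∞ f x₀ := by
  refine (hf.contMDiffAt.comp x₀ (contMDiffAt_extChartAt (I := 𝓡 m)
    (n := ∞))).congr_of_eventuallyEq ?_
  filter_upwards [extChartAt_source_mem_nhds (I := 𝓡 m) x₀] with x hx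
  exact congrArg f ((extChartAt (𝓡 m) x₀).left_inv hx).symm

variable [IsManifold (𝓡 m) ∞ M]

theorem contMDiffAt_extChartAt_symm {x₀ : M} {u : EuclideanSpace ℝ (Fin m)}
    (hu : u ∈ (extChartAt (𝓡 m) x₀).target) :
    ContMDiffAt 𝓘(ℝ, EuclideanSpace ℝ (Fin m)) (𝓡 m) ∞ (extChartAt (𝓡 m) x₀).symm u :=
  (contMDiffOn_extChartAt_symm x₀).contMDiffAt ((isOpen_extChartAt_target x₀).mem_nhds hu)

theorem contDiffAt_chart {f : M → ℂ} {x₀ : M} {u : EuclideanSpace ℝ (Fin m)}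
    (hu : u ∈ (extChartAt (𝓡 m) x₀).target)
    (hf : ContMDiffAt (𝓡 m) 𝓘(ℝ, ℂ) ∞ f ((extChartAt (𝓡 m) x₀).symm u)) :
    ContDiffAt ℝ ∞ (f ∘ (extChartAt (𝓡 m) x₀).symm) u :=
  (hf.comp u (contMDiffAt_extChartAt_symm hu)).contDiffAt

theorem diff_comp_chartFrame {f : M → ℂ} {x₀ : M} {u : EuclideanSpace ℝ (Fin m)}
    (hu : u ∈ (extChartAt (𝓡 m) x₀).target)
    (hf : MDifferentiableAt (𝓡 m) 𝓘(ℝ, ℂ) f ((extChartAt (𝓡 m) x₀).symm u)) :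
    (diff m f ((extChartAt (𝓡 m) x₀).symm u)).comp (chartFrame x₀ u) =
      fderiv ℝ (f ∘ (extChartAt (𝓡 m) x₀).symm) u := by
  have := mfderiv_comp u hf ((contMDiffAt_extChartAt_symm hu).mdifferentiableAt (by simp))
  rw [mfderiv_eq_fderiv] at this
  exact this.symm

theorem chartFrame_self (x : M) (v : EuclideanSpace ℝ (Fin m)) :
    chartFrame x (extChartAt (𝓡 m) x x) v = v := by
  have : IsManifold (𝓡 m) 1 M := .of_le (n := ∞) (by simp)
  have h := mfderivWithin_range_extChartAt_symm (I := 𝓡 m) (x := x)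
  rw [ModelWithCorners.range_eq_univ, mfderivWithin_univ] at h
  exact congrArg (fun L => L v) h

theorem chartFrame_bijective {x₀ : M} {u : EuclideanSpace ℝ (Fin m)}
    (hu : u ∈ (extChartAt (𝓡 m) x₀).target) : Function.Bijective (chartFrame x₀ u) := by
  have : IsManifold (𝓡 m) 1 M := .of_le (n := ∞) (by simp)
  have h := isInvertible_mfderivWithin_extChartAt_symm (I := 𝓡 m) hu
  rw [ModelWithCorners.range_eq_univ, mfderivWithin_univ] at h
  obtain ⟨e, he⟩ := h
  have : (e : EuclideanSpace ℝ (Fin m) → _) = chartFrame x₀ u := congrArg DFunLike.coe he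
  rw [← this]
  exact e.bijective

/-- On the chart domain the tangent bundle trivialization at `x₀` is inverted by `chartFrame`.
Smoothness as a section of the hom bundle is thus smoothness of the local expression that
`extDeriv₁` differentiates. -/
theorem contDiffAt_oneForm_chart {α : ∀ x : M, TangentSpace (𝓡 m) x →L[ℝ] ℝ}
    (hα : ContMDiff (𝓡 m) ((𝓡 m).prod 𝓘(ℝ, EuclideanSpace ℝ (Fin m) →L[ℝ] ℝ)) ∞
      (fun y => Bundle.TotalSpace.mk' (EuclideanSpace ℝ (Fin m) →L[ℝ] ℝ)
        (E := fun y : M => TangentSpace (𝓡 m) y →L[ℝ] ℝ) y (α y)))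
    (x₀ : M) :
    ContDiffAt ℝ ∞ (fun u => ((α ((extChartAt (𝓡 m) x₀).symm u)).comp (chartFrame x₀ u) :
      EuclideanSpace ℝ (Fin m) →L[ℝ] ℝ)) (extChartAt (𝓡 m) x₀ x₀) := by
  have : IsManifold (𝓡 m) 1 M := .of_le (n := ∞) (by simp)
  have h := ((contMDiffAt_hom_bundle (fun y => Bundle.TotalSpace.mk'
    (EuclideanSpace ℝ (Fin m) →L[ℝ] ℝ)
    (E := fun y : M => TangentSpace (𝓡 m) y →L[ℝ] (Bundle.Trivial M ℝ) y) y (α y))).1 (hα x₀)).2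
  have hu := mem_extChartAt_target (I := 𝓡 m) x₀
  have h' := h.comp_of_eq (contMDiffAt_extChartAt_symm hu) (extChartAt_to_inv x₀)
  refine h'.contDiffAt.congr_of_eventuallyEq ?_
  filter_upwards [(isOpen_extChartAt_target (I := 𝓡 m) x₀).mem_nhds hu] with u hu
  have hs : (extChartAt (𝓡 m) x₀).symm u ∈ (chartAt (EuclideanSpace ℝ (Fin m)) x₀).source := by
    rw [← extChartAt_source (𝓡 m)]
    exact (extChartAt (𝓡 m) x₀).map_target hu
  simp only [Function.comp_def, ContinuousLinearMap.inCoordinates]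
  rw [TangentBundle.symmL_trivializationAt hs, (extChartAt (𝓡 m) x₀).right_inv hu,
    ModelWithCorners.range_eq_univ, mfderivWithin_univ]
  ext v
  simp [chartFrame]

end Chart

/-! ### The frame of the complexified tangent bundle of `Y` over an adapted chart -/

section Frame

variable {n : ℕ} {X : Type*} [TopologicalSpace X]
  [ChartedSpace (EuclideanSpace ℝ (Fin (2 * n))) X] [IsManifold (𝓡 (2 * n)) ∞ X]
  {ħ : ℝ} {Ω : SymplecticForm n X} {Y : Type*} [TopologicalSpace Y]
  [ChartedSpace (EuclideanSpace ℝ (Fin (2 * n + 1))) Y] [IsManifold (𝓡 (2 * n + 1)) ∞ Y]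
  [MulAction Circle Y] (B : PrequantumBundle ħ Ω Y)
  {J K : ∀ x : X, Submodule ℂ (CTangent (2 * n) x)} (c : AdaptedChart Ω J K)

/-- The Darboux coordinates `p_j, q^j` as one family. -/
def AdaptedChart.coord : Fin n ⊕ Fin n → X → ℂ := Sum.elim c.p c.q

/-- The coordinate vector fields `∂_{p_j}, ∂_{q^j}` as one family. -/
def AdaptedChart.field : Fin n ⊕ Fin n → ∀ x : X, CTangent (2 * n) x := Sum.elim c.dp c.dq

theorem AdaptedChart.smooth_coord (a : Fin n ⊕ Fin n) {x : X} (hx : x ∈ c.U) :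
    ContMDiffAt (𝓡 (2 * n)) 𝓘(ℝ, ℂ) ∞ (c.coord a) x := by
  rcases a with j | j
  · exact (c.smooth_p j).contMDiffAt (c.isOpen.mem_nhds hx)
  · exact (c.smooth_q j).contMDiffAt (c.isOpen.mem_nhds hx)

theorem AdaptedChart.coord_field {x : X} (hx : x ∈ c.U) (a b : Fin n ⊕ Fin n) :
    cdiff (2 * n) (c.coord a) x (c.field b x) = if a = b then 1 else 0 := by
  rcases a with i | i <;> rcases b with j | j
  · simpa [coord, field] using c.p_dp x hx i j
  · simpa [coord, field] using c.p_dq x hx i j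
  · simpa [coord, field] using c.q_dp x hx i j
  · simpa [coord, field] using c.q_dq x hx i j

namespace PrequantumBundle

theorem split_hlift (y : Y) (v : TangentSpace (𝓡 (2 * n)) (B.proj y)) :
    B.split y (B.hlift y v) = (v, 0) :=
  (LinearEquiv.ofBijective (B.split y) (B.split_bijective y)).apply_symm_apply (v, 0)

theorem mfderiv_proj_hlift (y : Y) (v : TangentSpace (𝓡 (2 * n)) (B.proj y)) :
    mfderiv (𝓡 (2 * n + 1)) (𝓡 (2 * n)) B.proj y (B.hlift y v) = v :=
  congrArg Prod.fst (B.split_hlift y v)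

theorem α_hlift (y : Y) (v : TangentSpace (𝓡 (2 * n)) (B.proj y)) : B.α y (B.hlift y v) = 0 :=
  congrArg Prod.snd (B.split_hlift y v)

theorem diff_comp_proj {f : X → ℂ} {y : Y}
    (hf : MDifferentiableAt (𝓡 (2 * n)) 𝓘(ℝ, ℂ) f (B.proj y)) (v : TangentSpace (𝓡 (2 * n + 1)) y) :
    diff (2 * n + 1) (f ∘ B.proj) y v = diff (2 * n) f (B.proj y)
      (mfderiv (𝓡 (2 * n + 1)) (𝓡 (2 * n)) B.proj y v) := by
  rw [diff, mfderiv_comp y hf (B.smooth_proj.mdifferentiableAt (by simp))]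
  rfl

theorem cdiff_comp_proj_chlift {f : X → ℂ} {y : Y}
    (hf : MDifferentiableAt (𝓡 (2 * n)) 𝓘(ℝ, ℂ) f (B.proj y)) (ζ : CTangent (2 * n) (B.proj y)) :
    cdiff (2 * n + 1) (f ∘ B.proj) y (B.chlift y ζ) = cdiff (2 * n) f (B.proj y) ζ := by
  induction ζ using TensorProduct.induction_on with
  | zero => simp
  | add x y hx hy => simp only [map_add, hx, hy]
  | tmul a v =>
    simp only [cdiff, chlift, LinearMap.baseChange_tmul, LinearMap.liftBaseChange_tmul]
    congr 1
    exact (B.diff_comp_proj hf _).trans (congrArg _ (B.mfderiv_proj_hlift y v))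

/-- The part of `Y` over the adapted chart. -/
def region : Set Y := B.proj ⁻¹' c.U

theorem isOpen_region : IsOpen (B.region c) := c.isOpen.preimage B.smooth_proj.continuous

theorem smul_mem_region_iff (z : Circle) (y : Y) : z • y ∈ B.region c ↔ y ∈ B.region c := by
  rw [region, Set.mem_preimage, Set.mem_preimage, (B.fibre y (z • y)).2 ⟨z, rfl⟩]

/-- The frame `∂_{p_j}^#, ∂_{q^j}^#, η` of the complexified tangent bundle of `Y`. -/
def frame : Option (Fin n ⊕ Fin n) → ∀ y : Y, CTangent (2 * n + 1) y
  | none, y => 1 ⊗ₜ generator (2 * n + 1) y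
  | some a, y => B.chlift y (c.field a (B.proj y))

/-- The coframe `dp_j, dq^j, α` dual to `frame`. -/
def coframe : Option (Fin n ⊕ Fin n) → ∀ y : Y, TangentSpace (𝓡 (2 * n + 1)) y →L[ℝ] ℂ
  | none, y => Complex.ofRealCLM.comp (B.α y)
  | some a, y => diff (2 * n + 1) (c.coord a ∘ B.proj) y

/-- Horizontal lifts are killed by `α` and project to the coordinate fields; the generator is
vertical and normalized by `α`. -/
theorem coframe_frame {y : Y} (hy : y ∈ B.region c) (a b : Option (Fin n ⊕ Fin n)) :
    (B.coframe c a y).toLinearMap.liftBaseChange ℂ (B.frame c b y) = if a = b then 1 else 0 := by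
  have hc := fun a => (c.smooth_coord a hy).mdifferentiableAt (by simp)
  rcases a with _ | a <;> rcases b with _ | b
  · simp [coframe, frame, B.α_generator y]
  · have : ∀ ζ : CTangent (2 * n) (B.proj y),
        (B.coframe c none y).toLinearMap.liftBaseChange ℂ (B.chlift y ζ) = 0 := by
      intro ζ
      induction ζ using TensorProduct.induction_on with
      | zero => simp
      | add x y hx hy => simp only [map_add, hx, hy, add_zero]
      | tmul a v => simp [chlift, coframe, B.α_hlift y v]
    simpa [frame] using this _
  · simp [coframe, frame, B.diff_comp_proj (hc a), B.mfderiv_proj_generator y]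
  · have := B.cdiff_comp_proj_chlift (hc a) (c.field b (B.proj y))
    rw [c.coord_field hy] at this
    simp only [Option.some.injEq]
    exact this

/-- The derivative of a function along a field of the frame. -/
def frameDeriv (a : Option (Fin n ⊕ Fin n)) (g : Y → ℂ) : Y → ℂ := fun y =>
  cdiff (2 * n + 1) g y (B.frame c a y)

theorem frame_expansion {y : Y} (hy : y ∈ B.region c) (L : TangentSpace (𝓡 (2 * n + 1)) y →L[ℝ] ℂ)
    (v : TangentSpace (𝓡 (2 * n + 1)) y) :
    L v = ∑ a, L.toLinearMap.liftBaseChange ℂ (B.frame c a y) * B.coframe c a y v := by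
  have : FiniteDimensional ℝ (TangentSpace (𝓡 (2 * n + 1)) y) :=
    inferInstanceAs (FiniteDimensional ℝ (EuclideanSpace ℝ (Fin (2 * n + 1))))
  have hcard : Fintype.card (Option (Fin n ⊕ Fin n)) =
      Module.finrank ℂ (CTangent (2 * n + 1) y) := by
    rw [Module.finrank_baseChange]
    change _ = Module.finrank ℝ (EuclideanSpace ℝ (Fin (2 * n + 1)))
    simp [two_mul]
  have := eq_sum_of_dual_frame (fun a => B.frame c a y)
    (fun a => (B.coframe c a y).toLinearMap.liftBaseChange ℂ) (B.coframe_frame c hy) hcard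
    (L.toLinearMap.liftBaseChange ℂ) (1 ⊗ₜ v)
  simpa using this

theorem diff_eq_sum {y : Y} (hy : y ∈ B.region c) (g : Y → ℂ) (v : TangentSpace (𝓡 (2 * n + 1)) y) :
    diff (2 * n + 1) g y v = ∑ a, B.frameDeriv c a g y * B.coframe c a y v :=
  B.frame_expansion c hy _ v

/-- A relation with complex coefficients that holds on real vectors extends `ℂ`-linearly, and can
then be evaluated on the dual frame. -/
theorem coframe_linearIndependent {y : Y} (hy : y ∈ B.region c) {d : Option (Fin n ⊕ Fin n) → ℂ}
    (h : ∀ v : TangentSpace (𝓡 (2 * n + 1)) y, ∑ a, d a * B.coframe c a y v = 0)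
    (a : Option (Fin n ⊕ Fin n)) : d a = 0 := by
  have h' : ∀ ζ : CTangent (2 * n + 1) y,
      ∑ a, d a * (B.coframe c a y).toLinearMap.liftBaseChange ℂ ζ = 0 := by
    intro ζ
    induction ζ using TensorProduct.induction_on with
    | zero => simp
    | add x y hx hy => simp only [map_add, mul_add, Finset.sum_add_distrib, hx, hy, add_zero]
    | tmul b v =>
      have := congrArg (fun z => b * z) (h v)
      simp only [Finset.mul_sum, mul_zero] at this
      rw [← this]
      refine Finset.sum_congr rfl fun i _ => ?_
      simp
      ring
  simpa [B.coframe_frame c hy] using h' (B.frame c a y)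

/-! ### Smoothness of the frame -/

/-- The coframe in the preferred chart at `y₀`. -/
def chartCoframe (y₀ : Y) (a : Option (Fin n ⊕ Fin n)) (u : EuclideanSpace ℝ (Fin (2 * n + 1))) :
    EuclideanSpace ℝ (Fin (2 * n + 1)) →L[ℝ] ℂ :=
  (B.coframe c a ((extChartAt (𝓡 (2 * n + 1)) y₀).symm u)).comp (chartFrame y₀ u)

theorem eventually_mem_region {y₀ : Y} (hy₀ : y₀ ∈ B.region c) :
    ∀ᶠ u in 𝓝 (extChartAt (𝓡 (2 * n + 1)) y₀ y₀), u ∈ (extChartAt (𝓡 (2 * n + 1)) y₀).target ∧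
      (extChartAt (𝓡 (2 * n + 1)) y₀).symm u ∈ B.region c := by
  have hu := mem_extChartAt_target (I := 𝓡 (2 * n + 1)) y₀
  refine Filter.Eventually.and ((isOpen_extChartAt_target y₀).mem_nhds hu) ?_
  refine (contMDiffAt_extChartAt_symm hu).continuousAt.eventually_mem ?_
  rw [extChartAt_to_inv]
  exact (B.isOpen_region c).mem_nhds hy₀

theorem smooth_coord_comp_proj (a : Fin n ⊕ Fin n) {y : Y} (hy : y ∈ B.region c) :
    ContMDiffAt (𝓡 (2 * n + 1)) 𝓘(ℝ, ℂ) ∞ (c.coord a ∘ B.proj) y :=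
  (c.smooth_coord a hy).comp y B.smooth_proj.contMDiffAt

theorem chartCoframe_some {y₀ : Y} (hy₀ : y₀ ∈ B.region c) (a : Fin n ⊕ Fin n) :
    B.chartCoframe c y₀ (some a) =ᶠ[𝓝 (extChartAt (𝓡 (2 * n + 1)) y₀ y₀)]
      fderiv ℝ ((c.coord a ∘ B.proj) ∘ (extChartAt (𝓡 (2 * n + 1)) y₀).symm) := by
  filter_upwards [B.eventually_mem_region c hy₀] with u hu
  exact diff_comp_chartFrame hu.1 ((B.smooth_coord_comp_proj c a hu.2).mdifferentiableAt (by simp))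

theorem contDiffAt_chartCoframe {y₀ : Y} (hy₀ : y₀ ∈ B.region c) (a : Option (Fin n ⊕ Fin n)) :
    ContDiffAt ℝ ∞ (B.chartCoframe c y₀ a) (extChartAt (𝓡 (2 * n + 1)) y₀ y₀) := by
  rcases a with _ | a
  · exact (contDiffAt_const (c := Complex.ofRealCLM)).clm_comp
      (contDiffAt_oneForm_chart B.smooth_α y₀)
  · refine ContDiffAt.congr_of_eventuallyEq ?_ (B.chartCoframe_some c hy₀ a)
    refine (contDiffAt_chart (mem_extChartAt_target y₀) ?_).fderiv_right (m := ∞) (by simp)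
    rw [extChartAt_to_inv]
    exact B.smooth_coord_comp_proj c a hy₀

/-- The map `d ↦ ∑ d_a θ_a` sending coefficients to the 1-form they define, in the preferred chart
at `y₀`. -/
def chartCombination (y₀ : Y) (u : EuclideanSpace ℝ (Fin (2 * n + 1))) :
    (Option (Fin n ⊕ Fin n) → ℂ) →L[ℝ] (EuclideanSpace ℝ (Fin (2 * n + 1)) →L[ℝ] ℂ) :=
  ∑ a, ((ContinuousLinearMap.lsmul ℝ ℂ).flip (B.chartCoframe c y₀ a u)).comp
    (ContinuousLinearMap.proj a)

theorem chartCombination_apply (y₀ : Y) (u v : EuclideanSpace ℝ (Fin (2 * n + 1)))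
    (d : Option (Fin n ⊕ Fin n) → ℂ) :
    B.chartCombination c y₀ u d v = ∑ a, d a * B.chartCoframe c y₀ a u v := by
  simp [chartCombination]

theorem chartCombination_bijective {y₀ : Y} {u : EuclideanSpace ℝ (Fin (2 * n + 1))}
    (hu : u ∈ (extChartAt (𝓡 (2 * n + 1)) y₀).target)
    (hy : (extChartAt (𝓡 (2 * n + 1)) y₀).symm u ∈ B.region c) :
    Function.Bijective (B.chartCombination c y₀ u) := by
  have hb := chartFrame_bijective hu
  constructor
  · rw [injective_iff_map_eq_zero]
    intro d hd
    funext a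
    refine B.coframe_linearIndependent c hy (fun v => ?_) a
    obtain ⟨w, rfl⟩ := hb.2 v
    have := congrArg (fun L => L w) hd
    rw [chartCombination_apply] at this
    exact this
  · intro L
    let F : EuclideanSpace ℝ (Fin (2 * n + 1)) →L[ℝ] EuclideanSpace ℝ (Fin (2 * n + 1)) :=
      chartFrame y₀ u
    let e := (LinearEquiv.ofBijective F.toLinearMap hb).toContinuousLinearEquiv
    let L' : TangentSpace (𝓡 (2 * n + 1)) ((extChartAt (𝓡 (2 * n + 1)) y₀).symm u) →L[ℝ] ℂ :=
      L.comp e.symm.toContinuousLinearMap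
    -- The coefficients of a covector are its values on the frame, after transport to the tangent
    -- space by the inverse of `chartFrame`.
    refine ⟨fun a => L'.toLinearMap.liftBaseChange ℂ (B.frame c a _),
      ContinuousLinearMap.ext fun w => ?_⟩
    rw [chartCombination_apply]
    refine (B.frame_expansion c hy L' (chartFrame y₀ u w)).symm.trans ?_
    exact congrArg L (e.symm_apply_apply w)

end PrequantumBundle

end Frame

theorem contDiffAt_lsmul_flip {E G : Type*} [NormedAddCommGroup E] [NormedSpace ℝ E]
    [NormedAddCommGroup G] [NormedSpace ℝ G] [NormedSpace ℂ G] [IsScalarTower ℝ ℂ G] {θ : E → G}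
    {u : E} (hθ : ContDiffAt ℝ ∞ θ u) :
    ContDiffAt ℝ ∞ (fun u => (ContinuousLinearMap.lsmul ℝ ℂ).flip (θ u) : E → ℂ →L[ℝ] G) u :=
  (ContinuousLinearMap.lsmul ℝ ℂ : ℂ →L[ℝ] G →L[ℝ] G).flip.contDiff.contDiffAt.comp u hθ

/-! ### Smoothness of derivatives along the frame, and `d(dg) = 0` in the coframe -/

section FrameDeriv

variable {n : ℕ} {X : Type*} [TopologicalSpace X]
  [ChartedSpace (EuclideanSpace ℝ (Fin (2 * n))) X] [IsManifold (𝓡 (2 * n)) ∞ X]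
  {ħ : ℝ} {Ω : SymplecticForm n X} {Y : Type*} [TopologicalSpace Y]
  [ChartedSpace (EuclideanSpace ℝ (Fin (2 * n + 1))) Y] [IsManifold (𝓡 (2 * n + 1)) ∞ Y]
  [MulAction Circle Y] (B : PrequantumBundle ħ Ω Y)
  {J K : ∀ x : X, Submodule ℂ (CTangent (2 * n) x)} (c : AdaptedChart Ω J K)

namespace PrequantumBundle

theorem chartCombination_eq_equiv {y₀ : Y} {u : EuclideanSpace ℝ (Fin (2 * n + 1))}
    (hu : u ∈ (extChartAt (𝓡 (2 * n + 1)) y₀).target)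
    (hy : (extChartAt (𝓡 (2 * n + 1)) y₀).symm u ∈ B.region c) :
    ∃ e : (Option (Fin n ⊕ Fin n) → ℂ) ≃L[ℝ] (EuclideanSpace ℝ (Fin (2 * n + 1)) →L[ℝ] ℂ),
      (e : _ →L[ℝ] _) = B.chartCombination c y₀ u :=
  ⟨(LinearEquiv.ofBijective (B.chartCombination c y₀ u).toLinearMap
    (B.chartCombination_bijective c hu hy)).toContinuousLinearEquiv, by ext; rfl⟩

theorem contDiffAt_chartCombination {y₀ : Y} (hy₀ : y₀ ∈ B.region c) :
    ContDiffAt ℝ ∞ (B.chartCombination c y₀) (extChartAt (𝓡 (2 * n + 1)) y₀ y₀) := by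
  refine ContDiffAt.sum fun a _ => ContDiffAt.clm_comp ?_ contDiffAt_const
  exact contDiffAt_lsmul_flip (B.contDiffAt_chartCoframe c hy₀ a)

variable {g : Y → ℂ} (hg : ∀ y ∈ B.region c, ContMDiffAt (𝓡 (2 * n + 1)) 𝓘(ℝ, ℂ) ∞ g y)
include hg

theorem fderiv_chart_eq {y₀ : Y} {u : EuclideanSpace ℝ (Fin (2 * n + 1))}
    (hu : u ∈ (extChartAt (𝓡 (2 * n + 1)) y₀).target)
    (hy : (extChartAt (𝓡 (2 * n + 1)) y₀).symm u ∈ B.region c) :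
    fderiv ℝ (g ∘ (extChartAt (𝓡 (2 * n + 1)) y₀).symm) u = B.chartCombination c y₀ u
      (fun a => B.frameDeriv c a g ((extChartAt (𝓡 (2 * n + 1)) y₀).symm u)) := by
  rw [← diff_comp_chartFrame hu ((hg _ hy).mdifferentiableAt (by simp))]
  ext w
  rw [chartCombination_apply]
  exact B.diff_eq_sum c hy g _

/-- The fields `dp`, `dq` carry no smoothness assumption; only the coframe is known to be smooth.
The derivatives are the coefficients of `dg` in the coframe, obtained by applying the inverse of
`chartCombination`, and inversion is smooth at an invertible map. -/
theorem smooth_frameDeriv (a : Option (Fin n ⊕ Fin n)) {y₀ : Y} (hy₀ : y₀ ∈ B.region c) :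
    ContMDiffAt (𝓡 (2 * n + 1)) 𝓘(ℝ, ℂ) ∞ (B.frameDeriv c a g) y₀ := by
  refine contMDiffAt_of_contDiffAt_chart ?_
  have hu := mem_extChartAt_target (I := 𝓡 (2 * n + 1)) y₀
  have hy : (extChartAt (𝓡 (2 * n + 1)) y₀).symm (extChartAt (𝓡 (2 * n + 1)) y₀ y₀) ∈
      B.region c := by rwa [extChartAt_to_inv]
  obtain ⟨e, he⟩ := B.chartCombination_eq_equiv c hu hy
  have h1 : ContDiffAt ℝ ∞ (fun u => (B.chartCombination c y₀ u).inverse)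
      (extChartAt (𝓡 (2 * n + 1)) y₀ y₀) := by
    have := contDiffAt_map_inverse (n := ∞) e
    rw [he] at this
    exact this.comp _ (B.contDiffAt_chartCombination c hy₀)
  have h2 : ContDiffAt ℝ ∞ (fderiv ℝ (g ∘ (extChartAt (𝓡 (2 * n + 1)) y₀).symm))
      (extChartAt (𝓡 (2 * n + 1)) y₀ y₀) :=
    (contDiffAt_chart hu (hg _ hy)).fderiv_right (m := ∞) (by simp)
  refine (contDiffAt_pi.1 (h1.clm_apply h2) a).congr_of_eventuallyEq ?_
  filter_upwards [B.eventually_mem_region c hy₀] with u hu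
  obtain ⟨e, he⟩ := B.chartCombination_eq_equiv c hu.1 hu.2
  rw [B.fderiv_chart_eq c hg hu.1 hu.2, ← he, ContinuousLinearMap.inverse_equiv]
  simp

omit hg in
theorem chartCoframe_self (y₀ : Y) (a : Option (Fin n ⊕ Fin n))
    (v : TangentSpace (𝓡 (2 * n + 1)) y₀) :
    B.chartCoframe c y₀ a (extChartAt (𝓡 (2 * n + 1)) y₀ y₀) v = B.coframe c a y₀ v := by
  have h : ∀ y : Y, y = y₀ → ∀ w : EuclideanSpace ℝ (Fin (2 * n + 1)),
      B.coframe c a y w = B.coframe c a y₀ w := by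
    rintro _ rfl w
    rfl
  refine (h _ (extChartAt_to_inv y₀) _).trans ?_
  exact congrArg (B.coframe c a y₀) (chartFrame_self y₀ v)

omit hg in
-- These coframe members are exact, hence closed: this is the symmetry of the second derivative of a
-- coordinate.
theorem fderiv_chartCoframe_some {y₀ : Y} (hy₀ : y₀ ∈ B.region c) (a : Fin n ⊕ Fin n)
    (v w : EuclideanSpace ℝ (Fin (2 * n + 1))) :
    fderiv ℝ (B.chartCoframe c y₀ (some a)) (extChartAt (𝓡 (2 * n + 1)) y₀ y₀) v w =
      fderiv ℝ (B.chartCoframe c y₀ (some a)) (extChartAt (𝓡 (2 * n + 1)) y₀ y₀) w v := by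
  rw [(B.chartCoframe_some c hy₀ a).fderiv_eq]
  refine (ContDiffAt.isSymmSndFDerivAt (n := ∞) (contDiffAt_chart (mem_extChartAt_target y₀) ?_)
    (by
      rw [minSmoothness_of_isRCLikeNormedField]
      exact WithTop.coe_le_coe.2 (le_top (a := (2 : ℕ∞))))).eq v w
  rw [extChartAt_to_inv]
  exact B.smooth_coord_comp_proj c a hy₀

omit hg in
theorem fderiv_chartCoframe_none (y₀ : Y) (v w : EuclideanSpace ℝ (Fin (2 * n + 1))) :
    fderiv ℝ (B.chartCoframe c y₀ none) (extChartAt (𝓡 (2 * n + 1)) y₀ y₀) v w -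
      fderiv ℝ (B.chartCoframe c y₀ none) (extChartAt (𝓡 (2 * n + 1)) y₀ y₀) w v =
      (extDeriv₁ B.α y₀ v w : ℂ) := by
  have h := (contDiffAt_oneForm_chart B.smooth_α y₀).differentiableAt (by simp)
  have h' := ((ContinuousLinearMap.compL ℝ (EuclideanSpace ℝ (Fin (2 * n + 1))) ℝ ℂ
    Complex.ofRealCLM).hasFDerivAt.comp _ h.hasFDerivAt).fderiv
  have e : B.chartCoframe c y₀ none = ContinuousLinearMap.compL ℝ
    (EuclideanSpace ℝ (Fin (2 * n + 1))) ℝ ℂ Complex.ofRealCLM ∘ fun u =>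
      ((B.α ((extChartAt (𝓡 (2 * n + 1)) y₀).symm u)).comp (chartFrame y₀ u) :
      EuclideanSpace ℝ (Fin (2 * n + 1)) →L[ℝ] ℝ) := rfl
  rw [e, h']
  simp [extDeriv₁]

/-- This is `d(dg) = 0` for `dg = ∑ (X_a g) θ^a`, namely `∑ d(X_a g) ∧ θ^a + ∑ (X_a g) dθ^a = 0`. In
the second sum only `θ^none = α` is not closed. -/
theorem structure_equation_real {y₀ : Y} (hy₀ : y₀ ∈ B.region c)
    (v w : TangentSpace (𝓡 (2 * n + 1)) y₀) :
    ∑ a, (diff (2 * n + 1) (B.frameDeriv c a g) y₀ v * B.coframe c a y₀ w -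
        diff (2 * n + 1) (B.frameDeriv c a g) y₀ w * B.coframe c a y₀ v) +
      B.frameDeriv c none g y₀ * (extDeriv₁ B.α y₀ v w : ℂ) = 0 := by
  have hu := mem_extChartAt_target (I := 𝓡 (2 * n + 1)) y₀
  set u₀ := extChartAt (𝓡 (2 * n + 1)) y₀ y₀ with hu₀
  have hy : (extChartAt (𝓡 (2 * n + 1)) y₀).symm u₀ ∈ B.region c := by
    rwa [hu₀, extChartAt_to_inv]
  set d : Option (Fin n ⊕ Fin n) → EuclideanSpace ℝ (Fin (2 * n + 1)) → ℂ := fun a =>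
    B.frameDeriv c a g ∘ (extChartAt (𝓡 (2 * n + 1)) y₀).symm with hd
  have hdd : ∀ a, DifferentiableAt ℝ (d a) u₀ := fun a =>
    (contDiffAt_chart hu (B.smooth_frameDeriv c hg a hy)).differentiableAt (by simp)
  have hθ : ∀ a, DifferentiableAt ℝ (B.chartCoframe c y₀ a) u₀ := fun a =>
    (B.contDiffAt_chartCoframe c hy₀ a).differentiableAt (by simp)
  have hD : HasFDerivAt (fun u => ∑ a, d a u • B.chartCoframe c y₀ a u) _ u₀ :=
    HasFDerivAt.fun_sum fun a _ => (hdd a).hasFDerivAt.smul (hθ a).hasFDerivAt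
  have heq : fderiv ℝ (g ∘ (extChartAt (𝓡 (2 * n + 1)) y₀).symm) =ᶠ[𝓝 u₀]
      fun u => ∑ a, d a u • B.chartCoframe c y₀ a u := by
    filter_upwards [B.eventually_mem_region c hy₀] with u hu
    rw [B.fderiv_chart_eq c hg hu.1 hu.2]
    ext w
    rw [chartCombination_apply]
    simp [hd, -Fintype.sum_option, -Fintype.sum_sum_type]
  have hsymm := (ContDiffAt.isSymmSndFDerivAt (n := ∞) (contDiffAt_chart hu (hg _ hy))
    (by
      rw [minSmoothness_of_isRCLikeNormedField]
      exact WithTop.coe_le_coe.2 (le_top (a := (2 : ℕ∞))))).eq v w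
  -- Symmetry of the second derivative of `g` is now expressed through the product rule for the
  -- expansion in the coframe.
  rw [heq.fderiv_eq, hD.fderiv] at hsymm
  have hdv : ∀ a (v : TangentSpace (𝓡 (2 * n + 1)) y₀),
      diff (2 * n + 1) (B.frameDeriv c a g) y₀ v = fderiv ℝ (d a) u₀ v := fun a v =>
    diff_eq_fderiv ((B.smooth_frameDeriv c hg a hy₀).mdifferentiableAt (by simp)) v
  have hd0 : ∀ a, d a u₀ = B.frameDeriv c a g y₀ := fun a => by simp [hd, hu₀]
  have h1 : ∀ a, d a u₀ * fderiv ℝ (B.chartCoframe c y₀ a) u₀ v w -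
      d a u₀ * fderiv ℝ (B.chartCoframe c y₀ a) u₀ w v =
      if a = none then B.frameDeriv c none g y₀ * (extDeriv₁ B.α y₀ v w : ℂ) else 0 := by
    rintro (_ | a)
    · rw [← mul_sub, B.fderiv_chartCoframe_none c y₀ v w, hd0]
      simp
    · rw [B.fderiv_chartCoframe_some c hy₀ a v w, sub_self, if_neg (by simp)]
  have h2 := Finset.sum_congr (rfl : Finset.univ = Finset.univ) fun a _ => h1 a
  rw [Finset.sum_ite_eq' Finset.univ none] at h2
  simp only [Finset.mem_univ, if_true] at h2
  rw [← h2, ← Finset.sum_add_distrib]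
  simp only [hdv, ← B.chartCoframe_self c y₀]
  have hev : ∀ v w : EuclideanSpace ℝ (Fin (2 * n + 1)),
      (∑ a, (d a u₀ • fderiv ℝ (B.chartCoframe c y₀ a) u₀ +
        (fderiv ℝ (d a) u₀).smulRight (B.chartCoframe c y₀ a u₀))) v w =
      ∑ a, (d a u₀ * fderiv ℝ (B.chartCoframe c y₀ a) u₀ v w +
        fderiv ℝ (d a) u₀ v * B.chartCoframe c y₀ a u₀ w) := by
    intro v w
    simp [-Fintype.sum_option, -Fintype.sum_sum_type]
  have h3 := ((hev v w).symm.trans hsymm).trans (hev w v)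
  rw [← sub_eq_zero, ← Finset.sum_sub_distrib] at h3
  rw [← h3]
  refine Finset.sum_congr rfl fun a _ => ?_
  ring

end PrequantumBundle

end FrameDeriv

/-! ### Commutators of the lifted fields and the action of the circle -/

section Commutators

variable {n : ℕ} {X : Type*} [TopologicalSpace X]
  [ChartedSpace (EuclideanSpace ℝ (Fin (2 * n))) X] [IsManifold (𝓡 (2 * n)) ∞ X]
  {ħ : ℝ} {Ω : SymplecticForm n X} {Y : Type*} [TopologicalSpace Y]
  [ChartedSpace (EuclideanSpace ℝ (Fin (2 * n + 1))) Y] [IsManifold (𝓡 (2 * n + 1)) ∞ Y]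
  [MulAction Circle Y] (B : PrequantumBundle ħ Ω Y)
  {J K : ∀ x : X, Submodule ℂ (CTangent (2 * n) x)} (c : AdaptedChart Ω J K)

namespace PrequantumBundle

theorem curvature_eq_sum {y : Y} (hy : y ∈ B.region c) (v w : TangentSpace (𝓡 (2 * n + 1)) y) :
    (extDeriv₁ B.α y v w : ℂ) = (1 / ħ : ℂ) * ∑ j,
      (B.coframe c (some (.inl j)) y v * B.coframe c (some (.inr j)) y w -
        B.coframe c (some (.inl j)) y w * B.coframe c (some (.inr j)) y v) := by
  have hc := fun a => (c.smooth_coord a hy).mdifferentiableAt (by simp)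
  rw [B.curvature, Complex.ofReal_mul, c.darboux _ hy]
  simp only [coframe, B.diff_comp_proj (hc _)]
  simp [AdaptedChart.coord]

/-- The exterior derivative of `dg = ∑ (X_a g) θ^a` vanishes. -/
theorem structure_equation {g : Y → ℂ}
    (hg : ∀ y ∈ B.region c, ContMDiffAt (𝓡 (2 * n + 1)) 𝓘(ℝ, ℂ) ∞ g y)
    {y : Y} (hy : y ∈ B.region c) (a b : Fin n ⊕ Fin n) :
    B.frameDeriv c (some a) (B.frameDeriv c (some b) g) y -
      B.frameDeriv c (some b) (B.frameDeriv c (some a) g) y +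
      B.frameDeriv c none g y * ((1 / ħ : ℂ) * ∑ j,
        ((if .inl j = a then 1 else 0) * (if .inr j = b then 1 else 0) -
          (if .inl j = b then 1 else 0) * (if .inr j = a then 1 else 0))) = 0 := by
  let θ := fun a => (B.coframe c a y).toLinearMap.liftBaseChange ℂ
  let δ := fun a => cdiff (2 * n + 1) (B.frameDeriv c a g) y
  -- The wedge product of two complex covectors, as a bilinear form. The identity is known on real
  -- vectors, so it extends to complex ones and can be evaluated on the frame.
  let W := fun f h : CTangent (2 * n + 1) y →ₗ[ℂ] ℂ =>
    (LinearMap.mul ℂ ℂ).compl₁₂ f h - ((LinearMap.mul ℂ ℂ).compl₁₂ f h).flip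
  have hQ : ∑ a, W (δ a) (θ a) + (B.frameDeriv c none g y * (1 / ħ : ℂ)) •
      ∑ j, W (θ (some (.inl j))) (θ (some (.inr j))) = 0 := by
    refine bilinear_eq_zero_of_real _ fun v w => ?_
    have h := B.structure_equation_real c hg hy v w
    rw [B.curvature_eq_sum c hy, ← mul_assoc] at h
    simpa [W, θ, δ, cdiff, LinearMap.sum_apply, -Fintype.sum_option, -Fintype.sum_sum_type] using h
  have h := congrArg (fun Q => Q (B.frame c (some a) y) (B.frame c (some b) y)) hQ
  have hδ : ∀ a b, δ a (B.frame c b y) = B.frameDeriv c b (B.frameDeriv c a g) y := fun _ _ => rfl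
  have hθ : ∀ a b, θ a (B.frame c b y) = if a = b then 1 else 0 := B.coframe_frame c hy
  simp only [W, LinearMap.add_apply, LinearMap.sum_apply, LinearMap.sub_apply, LinearMap.smul_apply,
    LinearMap.flip_apply, LinearMap.compl₁₂_apply, LinearMap.mul_apply', hδ, hθ,
    Option.some.injEq, Finset.sum_sub_distrib, mul_ite, mul_one, mul_zero, Finset.sum_ite_eq',
    Finset.mem_univ, if_true, LinearMap.zero_apply, smul_eq_mul] at h
  refine Eq.trans ?_ h
  simp only [Finset.sum_sub_distrib, mul_ite, mul_one, mul_zero]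
  ring

/-! ### Equivariance -/

include B in
theorem contMDiff_smul (z : Circle) :
    ContMDiff (𝓡 (2 * n + 1)) (𝓡 (2 * n + 1)) ∞ (fun y : Y => z • y) := by
  have := B.smooth_smul
  exact (ContMDiffSMul.contMDiff_smul (I := 𝓡 1) (I' := 𝓡 (2 * n + 1)) (n := ∞) (G := Circle)
    (M := Y)).comp (contMDiff_const.prodMk contMDiff_id)

include B in
theorem diff_smul {g : Y → ℂ} {k : ℕ} (hk : ∀ (z : Circle) y, g (z • y) = (z : ℂ) ^ k * g y)
    (z : Circle) {y : Y} (hg : MDifferentiableAt (𝓡 (2 * n + 1)) 𝓘(ℝ, ℂ) g y)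
    (hg' : MDifferentiableAt (𝓡 (2 * n + 1)) 𝓘(ℝ, ℂ) g (z • y))
    (v : TangentSpace (𝓡 (2 * n + 1)) y) :
    diff (2 * n + 1) g (z • y)
      (mfderiv (𝓡 (2 * n + 1)) (𝓡 (2 * n + 1)) (fun y' : Y => z • y') y v) =
      (z : ℂ) ^ k * diff (2 * n + 1) g y v := by
  have h1 := mfderiv_comp y hg' ((B.contMDiff_smul z).mdifferentiableAt (by simp) (x := y))
  have h2 : g ∘ (fun y' : Y => z • y') = ContinuousLinearMap.mul ℝ ℂ ((z : ℂ) ^ k) ∘ g :=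
    funext fun y' => hk z y'
  rw [h2] at h1
  have h3 := ((ContinuousLinearMap.mul ℝ ℂ ((z : ℂ) ^ k)).hasMFDerivAt.comp y
    hg.hasMFDerivAt).mfderiv
  exact (congrArg (fun L => L v) (h3.symm.trans h1)).symm

/-- The coframe is invariant under the circle action and `dg` has weight `k`, so comparing
coefficients of `dg` at `y` and at `z • y` suffices. Invariance of the frame itself is not needed.
-/
theorem frameDeriv_smul {g : Y → ℂ} {k : ℕ}
    (hg : ∀ y ∈ B.region c, ContMDiffAt (𝓡 (2 * n + 1)) 𝓘(ℝ, ℂ) ∞ g y)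
    (hk : ∀ (z : Circle) y, g (z • y) = (z : ℂ) ^ k * g y) (z : Circle) {y : Y}
    (hy : y ∈ B.region c) (a : Option (Fin n ⊕ Fin n)) :
    B.frameDeriv c a g (z • y) = (z : ℂ) ^ k * B.frameDeriv c a g y := by
  have hzy := (B.smul_mem_region_iff c z y).2 hy
  rw [← sub_eq_zero]
  refine B.coframe_linearIndependent c hy (d := fun a =>
    B.frameDeriv c a g (z • y) - (z : ℂ) ^ k * B.frameDeriv c a g y) (fun v => ?_) a
  have hθ : ∀ a, B.coframe c a (z • y)
      (mfderiv (𝓡 (2 * n + 1)) (𝓡 (2 * n + 1)) (fun y' : Y => z • y') y v) =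
      B.coframe c a y v := by
    rintro (_ | a)
    · simp [coframe, B.α_invariant z y v]
    · have := B.diff_smul (g := c.coord a ∘ B.proj) (k := 0)
        (fun z y => by simp [(B.fibre y (z • y)).2 ⟨z, rfl⟩]) z
        ((B.smooth_coord_comp_proj c a hy).mdifferentiableAt (by simp))
        ((B.smooth_coord_comp_proj c a hzy).mdifferentiableAt (by simp)) v
      rwa [pow_zero, one_mul] at this
  have h := B.diff_smul hk z ((hg y hy).mdifferentiableAt (by simp))
    ((hg _ hzy).mdifferentiableAt (by simp)) v
  rw [B.diff_eq_sum c hy g v, B.diff_eq_sum c hzy g, Finset.mul_sum, ← sub_eq_zero,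
    ← Finset.sum_sub_distrib] at h
  refine Eq.trans ?_ h
  refine Finset.sum_congr rfl fun a _ => ?_
  rw [hθ]
  ring

/-- Along the orbit through `y` the function is `exp(i k t) g(y)`; differentiate at `t = 0`. -/
theorem frameDeriv_none {g : Y → ℂ} {k : ℕ} {y : Y}
    (hg : MDifferentiableAt (𝓡 (2 * n + 1)) 𝓘(ℝ, ℂ) g y)
    (hk : ∀ (z : Circle) y, g (z • y) = (z : ℂ) ^ k * g y) :
    B.frameDeriv c none g y = Complex.I * k * g y := by
  have := B.smooth_smul
  have h1 : ContMDiff 𝓘(ℝ, ℝ) (𝓡 (2 * n + 1)) ∞ (fun t : ℝ => Circle.exp t • y) :=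
    (ContMDiffSMul.contMDiff_smul (I := 𝓡 1) (I' := 𝓡 (2 * n + 1)) (n := ∞) (G := Circle)
      (M := Y)).comp (contMDiff_circleExp.prodMk contMDiff_const)
  have h0 : ∀ y' : Y, y' = y → ∀ v : EuclideanSpace ℝ (Fin (2 * n + 1)),
      (diff (2 * n + 1) g y' v : ℂ) = diff (2 * n + 1) g y v := by
    rintro _ rfl v
    rfl
  have hg' : MDifferentiableAt (𝓡 (2 * n + 1)) 𝓘(ℝ, ℂ) g (Circle.exp 0 • y) := by simpa using hg
  have key := mfderiv_comp (0 : ℝ) hg' (h1.mdifferentiableAt (by simp))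
  have hc : g ∘ (fun t : ℝ => Circle.exp t • y) =
      fun t : ℝ => Complex.exp (Complex.I * k * t) * g y := by
    funext t
    simp only [Function.comp_apply, hk, Circle.coe_exp, ← Complex.exp_nat_mul]
    congr 2
    ring
  rw [hc, mfderiv_eq_fderiv] at key
  have hd : HasDerivAt (fun t : ℝ => Complex.exp (Complex.I * k * t) * g y)
      (Complex.I * k * g y) 0 := by
    have h2 : HasDerivAt (fun t : ℝ => Complex.I * k * (t : ℂ)) (Complex.I * k * 1) 0 :=
      (Complex.ofRealCLM.hasDerivAt (x := (0 : ℝ))).const_mul _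
    have := h2.cexp.mul_const (g y)
    simpa using this
  have key2 : (fderiv ℝ (fun t : ℝ => Complex.exp (Complex.I * k * t) * g y) 0) 1 =
      diff (2 * n + 1) g (Circle.exp 0 • y) (generator (2 * n + 1) y) :=
    congrArg (fun L => L (1 : ℝ)) key
  rw [hd.hasFDerivAt.fderiv] at key2
  rw [h0 (Circle.exp 0 • y) (by simp) (generator (2 * n + 1) y)] at key2
  simpa [frameDeriv, frame, cdiff] using key2.symm

end PrequantumBundle

end Commutators

/-- If `[p, π] = z d` and `d` commutes with `π` then `[p, π^k] = k z d π^(k-1)`. -/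
theorem mul_pow_succ_of_commutator {R : Type*} [Ring R] [Algebra ℂ R] {d p π : R} {z : ℂ}
    (hd : d * π = π * d) (hp : p * π = π * p + z • d) (k : ℕ) :
    p * π ^ (k + 1) = π ^ (k + 1) * p + (((k : ℂ) + 1) * z) • (π ^ k * d) := by
  induction k with
  | zero => simp [hp]
  | succ k ih =>
    rw [pow_succ, ← mul_assoc, ih, add_mul, mul_assoc, hp, smul_mul_assoc, mul_assoc (π ^ k), hd,
      ← mul_assoc (π ^ k), ← pow_succ, mul_add, ← mul_assoc, ← pow_succ, mul_smul_comm, add_assoc,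
      ← add_smul]
    congr 2
    push_cast
    ring

/-! ### Weight spaces of the circle action and operators on their tensor product -/

section Weight

variable {n : ℕ} {X : Type*} [TopologicalSpace X]
  [ChartedSpace (EuclideanSpace ℝ (Fin (2 * n))) X] [IsManifold (𝓡 (2 * n)) ∞ X]
  {ħ : ℝ} {Ω : SymplecticForm n X} {Y : Type*} [TopologicalSpace Y]
  [ChartedSpace (EuclideanSpace ℝ (Fin (2 * n + 1))) Y] [IsManifold (𝓡 (2 * n + 1)) ∞ Y]
  [MulAction Circle Y] (B : PrequantumBundle ħ Ω Y)
  {J K : ∀ x : X, Submodule ℂ (CTangent (2 * n) x)} (c : AdaptedChart Ω J K)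

namespace PrequantumBundle

theorem frameDeriv_congr {f g : Y → ℂ} (h : Set.EqOn f g (B.region c))
    (a : Option (Fin n ⊕ Fin n)) {y : Y} (hy : y ∈ B.region c) :
    B.frameDeriv c a f y = B.frameDeriv c a g y := by
  have : f =ᶠ[𝓝 y] g := h.eventuallyEq_of_mem ((B.isOpen_region c).mem_nhds hy)
  rw [frameDeriv, frameDeriv, cdiff, cdiff, diff, diff, this.mfderiv_eq]

theorem cdiff_add {m : ℕ} {M : Type*} [TopologicalSpace M]
    [ChartedSpace (EuclideanSpace ℝ (Fin m)) M] {f g : M → ℂ} {x : M}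
    (hf : MDifferentiableAt (𝓡 m) 𝓘(ℝ, ℂ) f x) (hg : MDifferentiableAt (𝓡 m) 𝓘(ℝ, ℂ) g x) :
    cdiff m (f + g) x = cdiff m f x + cdiff m g x := by
  have : diff m (f + g) x = diff m f x + diff m g x := mfderiv_add hf hg
  ext v
  simp [cdiff, this]

theorem cdiff_mul {m : ℕ} {M : Type*} [TopologicalSpace M]
    [ChartedSpace (EuclideanSpace ℝ (Fin m)) M] {f g : M → ℂ} {x : M}
    (hf : MDifferentiableAt (𝓡 m) 𝓘(ℝ, ℂ) f x) (hg : MDifferentiableAt (𝓡 m) 𝓘(ℝ, ℂ) g x) :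
    cdiff m (f * g) x = f x • cdiff m g x + g x • cdiff m f x := by
  have : diff m (f * g) x = f x • diff m g x + g x • diff m f x :=
    (hf.hasMFDerivAt.mul hg.hasMFDerivAt).mfderiv
  ext v
  simp [cdiff, this]

theorem cdiff_const_smul {m : ℕ} {M : Type*} [TopologicalSpace M]
    [ChartedSpace (EuclideanSpace ℝ (Fin m)) M] (z : ℂ) {f : M → ℂ} {x : M}
    (hf : MDifferentiableAt (𝓡 m) 𝓘(ℝ, ℂ) f x) :
    cdiff m (z • f) x = z • cdiff m f x := by
  have h := cdiff_mul (f := fun _ => z) mdifferentiableAt_const hf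
  have h0 : cdiff m (fun _ : M => z) x = 0 := by
    rw [cdiff, diff, mfderiv_const]
    exact map_zero (LinearMap.liftBaseChangeEquiv (R := ℝ) (N := ℂ) ℂ)
  rw [h0, smul_zero, add_zero] at h
  exact h

theorem contMDiffAt_mul_complex {m : ℕ} {M : Type*} [TopologicalSpace M]
    [ChartedSpace (EuclideanSpace ℝ (Fin m)) M] {f g : M → ℂ} {x : M}
    (hf : ContMDiffAt (𝓡 m) 𝓘(ℝ, ℂ) ∞ f x) (hg : ContMDiffAt (𝓡 m) 𝓘(ℝ, ℂ) ∞ g x) :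
    ContMDiffAt (𝓡 m) 𝓘(ℝ, ℂ) ∞ (f * g) x :=
  ((contDiff_mul (𝕜 := ℝ) (𝔸 := ℂ) (n := ∞)).contMDiff.contMDiffAt).comp x (hf.prodMk_space hg)

/-- The functions on `Y` that are smooth over the adapted chart, of weight `k` under the circle
action and, for definiteness, zero outside the chart. -/
def weightSpace (k : ℕ) : Submodule ℂ (Y → ℂ) where
  carrier := {g | (∀ y ∈ B.region c, ContMDiffAt (𝓡 (2 * n + 1)) 𝓘(ℝ, ℂ) ∞ g y) ∧
    (∀ (z : Circle) y, g (z • y) = (z : ℂ) ^ k * g y) ∧ ∀ y ∉ B.region c, g y = 0}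
  add_mem' := by
    rintro f g ⟨hf, hf', hf''⟩ ⟨hg, hg', hg''⟩
    refine ⟨fun y hy => (hf y hy).add (hg y hy), fun z y => ?_, fun y hy => ?_⟩
    · simp [hf', hg', mul_add]
    · simp [hf'' y hy, hg'' y hy]
  zero_mem' := ⟨fun y _ => contMDiffAt_const, by simp, by simp⟩
  smul_mem' := by
    rintro z f ⟨hf, hf', hf''⟩
    refine ⟨fun y hy => contMDiffAt_mul_complex contMDiffAt_const (hf y hy), fun w y => ?_, fun y hy => ?_⟩
    · simp only [Pi.smul_apply, hf', smul_eq_mul]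
      ring
    · simp [hf'' y hy]

/-- The type of elements of `weightSpace`. -/
def WeightFun (k : ℕ) : Type _ := B.weightSpace c k

instance (k : ℕ) : AddCommGroup (B.WeightFun c k) :=
  inferInstanceAs (AddCommGroup (B.weightSpace c k))

instance (k : ℕ) : Module ℂ (B.WeightFun c k) := inferInstanceAs (Module ℂ (B.weightSpace c k))

instance (k : ℕ) : CoeFun (B.WeightFun c k) fun _ => Y → ℂ := ⟨Subtype.val⟩

/-- Evaluation at a point. -/
def evalAt (k : ℕ) (y : Y) : B.WeightFun c k →ₗ[ℂ] ℂ :=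
  LinearMap.proj y ∘ₗ (B.weightSpace c k).subtype

variable {B c}

theorem indicator_mem_weightSpace {k : ℕ} {g : Y → ℂ}
    (hg : ∀ y ∈ B.region c, ContMDiffAt (𝓡 (2 * n + 1)) 𝓘(ℝ, ℂ) ∞ g y)
    (hk : ∀ (z : Circle), ∀ y ∈ B.region c, g (z • y) = (z : ℂ) ^ k * g y) :
    (B.region c).indicator g ∈ B.weightSpace c k := by
  refine ⟨fun y hy => (hg y hy).congr_of_eventuallyEq ?_, fun z y => ?_, fun y hy => ?_⟩
  · exact (Set.eqOn_indicator).eventuallyEq_of_mem ((B.isOpen_region c).mem_nhds hy)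
  · by_cases hy : y ∈ B.region c
    · rw [Set.indicator_of_mem hy, Set.indicator_of_mem ((B.smul_mem_region_iff c z y).2 hy),
        hk z y hy]
    · rw [Set.indicator_of_notMem hy,
        Set.indicator_of_notMem (mt (B.smul_mem_region_iff c z y).1 hy), mul_zero]
  · exact Set.indicator_of_notMem hy g

@[simp]
theorem add_apply {k : ℕ} (f g : B.WeightFun c k) (y : Y) : (f + g) y = f y + g y := rfl

@[simp]
theorem sub_apply {k : ℕ} (f g : B.WeightFun c k) (y : Y) : (f - g) y = f y - g y := rfl

@[simp]
theorem smul_apply {k : ℕ} (z : ℂ) (f : B.WeightFun c k) (y : Y) : (z • f) y = z * f y := rfl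

@[simp]
theorem zero_apply {k : ℕ} (y : Y) : (0 : B.WeightFun c k) y = 0 := rfl

@[simp]
theorem evalAt_apply {k : ℕ} (f : B.WeightFun c k) (y : Y) : B.evalAt c k y f = f y := rfl

theorem weightFun_mdifferentiableAt {k : ℕ} (g : B.WeightFun c k) {y : Y}
    (hy : y ∈ B.region c) : MDifferentiableAt (𝓡 (2 * n + 1)) 𝓘(ℝ, ℂ) (g) y :=
  (g.2.1 y hy).mdifferentiableAt (by simp)

/-- The point of extending by zero: operator identities need to be verified only over the chart,
where derivatives are meaningful. -/
theorem weightFun_ext {k : ℕ} {f g : B.WeightFun c k}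
    (h : ∀ y ∈ B.region c, (f) y = (g) y) : f = g := by
  refine Subtype.ext (funext fun y => ?_)
  by_cases hy : y ∈ B.region c
  · exact h y hy
  · rw [f.2.2.2 y hy, g.2.2.2 y hy]

variable (B c)

/-- The derivative of a function of weight `k` along `∂_{p_j}^#` or `∂_{q^j}^#`. -/
def liftFun (k : ℕ) (a : Fin n ⊕ Fin n) (g : B.WeightFun c k) : B.WeightFun c k :=
  ⟨(B.region c).indicator (B.frameDeriv c (some a) g), indicator_mem_weightSpace
    (fun _ hy => B.smooth_frameDeriv c g.2.1 (some a) hy)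
    (fun z _ hy => B.frameDeriv_smul c g.2.1 g.2.2.1 z hy (some a))⟩

variable {B c}

theorem liftFun_apply {k : ℕ} (a : Fin n ⊕ Fin n) (g : B.WeightFun c k) {y : Y}
    (hy : y ∈ B.region c) : B.liftFun c k a g y = B.frameDeriv c (some a) g y :=
  Set.indicator_of_mem hy _

variable (B c)

/-- The derivatives `∂_{p_j}^#, ∂_{q^j}^#` as endomorphisms of the space of functions of weight
`k`. -/
def lift (k : ℕ) (a : Fin n ⊕ Fin n) : Module.End ℂ (B.WeightFun c k) where
  toFun := B.liftFun c k a
  map_add' f g := weightFun_ext fun y hy => by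
    have h := cdiff_add (weightFun_mdifferentiableAt f hy) (weightFun_mdifferentiableAt g hy)
    rw [add_apply, liftFun_apply _ _ hy, liftFun_apply _ _ hy, liftFun_apply _ _ hy]
    exact congrArg (fun L => L (B.frame c (some a) y)) h
  map_smul' z g := weightFun_ext fun y hy => by
    have h := cdiff_const_smul z (weightFun_mdifferentiableAt g hy)
    rw [RingHom.id_apply, smul_apply, liftFun_apply _ _ hy, liftFun_apply _ _ hy]
    exact congrArg (fun L => L (B.frame c (some a) y)) h

variable {B c}

theorem lift_apply {k : ℕ} (a : Fin n ⊕ Fin n) (g : B.WeightFun c k) {y : Y}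
    (hy : y ∈ B.region c) : B.lift c k a g y = B.frameDeriv c (some a) g y :=
  liftFun_apply a g hy

/-- The inner derivative has been cut off outside the chart, which is harmless because the region is
open and differentiation is local. -/
theorem lift_lift_apply {k : ℕ} (a b : Fin n ⊕ Fin n) (g : B.WeightFun c k) {y : Y}
    (hy : y ∈ B.region c) :
    (B.lift c k a (B.lift c k b g)) y =
      B.frameDeriv c (some a) (B.frameDeriv c (some b) g) y := by
  rw [lift_apply _ _ hy]
  exact B.frameDeriv_congr c Set.eqOn_indicator _ hy

/-- On a fixed weight the vertical derivative in the commutator is multiplication by `i k`, so the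
commutator becomes a scalar operator. -/
theorem structure_equation_weight {k : ℕ} (a b : Fin n ⊕ Fin n) :
    B.lift c k a * B.lift c k b = B.lift c k b * B.lift c k a -
      (Complex.I * k * ((1 / ħ : ℂ) * ∑ j : Fin n,
        ((if .inl j = a then 1 else 0) * (if .inr j = b then 1 else 0) -
          (if .inl j = b then 1 else 0) * (if .inr j = a then 1 else 0)))) • 1 := by
  refine LinearMap.ext fun g => weightFun_ext fun y hy => ?_
  have h := B.structure_equation c g.2.1 hy a b
  rw [B.frameDeriv_none c (weightFun_mdifferentiableAt g hy) g.2.2.1] at h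
  simp only [Module.End.mul_apply, LinearMap.sub_apply, LinearMap.smul_apply, Module.End.one_apply,
    sub_apply, smul_apply,
    lift_lift_apply _ _ g hy]
  linear_combination h

theorem lift_commute (a b : Fin n ⊕ Fin n) :
    B.lift c 0 a * B.lift c 0 b = B.lift c 0 b * B.lift c 0 a := by
  rw [structure_equation_weight]
  simp

theorem lift_inl_inl {k : ℕ} (i j : Fin n) :
    B.lift c k (.inl i) * B.lift c k (.inl j) = B.lift c k (.inl j) * B.lift c k (.inl i) := by
  rw [structure_equation_weight]
  simp

theorem lift_inl_inr (i j : Fin n) :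
    B.lift c 1 (.inl i) * B.lift c 1 (.inr j) = B.lift c 1 (.inr j) * B.lift c 1 (.inl i) +
      (if i = j then -(Complex.I / ħ) else 0) • 1 := by
  rw [structure_equation_weight, sub_eq_add_neg, ← neg_smul]
  congr 2
  by_cases h : i = j
  · subst h
    simp [div_eq_mul_inv]
  · simp [h]
    rintro rfl
    exact absurd rfl h

/-! ### Functions of two variables -/

variable (B c)

/-- The tensors `∑ f ⊗ g` of an invariant and an equivariant function. -/
abbrev Tensor : Type _ := B.WeightFun c 0 ⊗[ℂ] B.WeightFun c 1

/-- A tensor as a function of two variables. -/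
def eval₂ : B.Tensor c →ₗ[ℂ] (Y × Y → ℂ) :=
  TensorProduct.lift (LinearMap.mk₂ ℂ (fun f g => tensorFun (f) (g))
    (by intros; ext; simp [tensorFun, add_mul]) (by intros; ext; simp [tensorFun, mul_assoc])
    (by intros; ext; simp [tensorFun, mul_add]) (by intros; ext; simp [tensorFun]; ring))

/-- The function of the second variable obtained from a tensor by fixing the first one. -/
def sliceLeft (y : Y) : B.Tensor c →ₗ[ℂ] B.WeightFun c 1 :=
  (TensorProduct.lid ℂ _).toLinearMap ∘ₗ
    (B.evalAt c 0 y).rTensor _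

/-- The function of the first variable obtained from a tensor by fixing the second one. -/
def sliceRight (y : Y) : B.Tensor c →ₗ[ℂ] B.WeightFun c 0 :=
  (TensorProduct.rid ℂ _).toLinearMap ∘ₗ
    (B.evalAt c 1 y).lTensor _

/-- The product of an invariant and an equivariant function. -/
def weightMul (f : B.WeightFun c 0) (g : B.WeightFun c 1) : B.WeightFun c 1 :=
  ⟨f.1 * g.1, fun y hy => contMDiffAt_mul_complex (f.2.1 y hy) (g.2.1 y hy),
    fun z y => by simp [f.2.2.1 z y, g.2.2.1 z y]; ring, fun y hy => by simp [f.2.2.2 y hy]⟩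

@[simp]
theorem weightMul_apply (f : B.WeightFun c 0) (g : B.WeightFun c 1) (y : Y) :
    B.weightMul c f g y = f y * g y := rfl

/-- The restriction of a tensor to the diagonal. -/
def diagonal : B.Tensor c →ₗ[ℂ] B.WeightFun c 1 :=
  TensorProduct.lift (LinearMap.mk₂ ℂ (B.weightMul c)
    (fun _ _ _ => weightFun_ext fun y _ => by simp [add_mul])
    (fun _ _ _ => weightFun_ext fun y _ => by simp [mul_assoc])
    (fun _ _ _ => weightFun_ext fun y _ => by simp [mul_add])
    (fun _ _ _ => weightFun_ext fun y _ => by simp; ring))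

/-- The operator `π^#` on tensors. -/
def poisson : Module.End ℂ (B.Tensor c) :=
  ∑ j, (TensorProduct.map (B.lift c 0 (.inl j)) (B.lift c 1 (.inr j)) -
    TensorProduct.map (B.lift c 0 (.inr j)) (B.lift c 1 (.inl j)))

variable {B c}

@[simp]
theorem eval₂_tmul (f : B.WeightFun c 0) (g : B.WeightFun c 1) (w : Y × Y) :
    B.eval₂ c (f ⊗ₜ g) w = (f) w.1 * (g) w.2 := rfl

theorem sliceLeft_apply (t : B.Tensor c) (y y' : Y) :
    (B.sliceLeft c y t) y' = B.eval₂ c t (y, y') := by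
  induction t using TensorProduct.induction_on with
  | zero => simp
  | add s t hs ht => simp [hs, ht]
  | tmul f g => simp [sliceLeft]

theorem sliceRight_apply (t : B.Tensor c) (y y' : Y) :
    (B.sliceRight c y' t) y = B.eval₂ c t (y, y') := by
  induction t using TensorProduct.induction_on with
  | zero => simp
  | add s t hs ht => simp [hs, ht]
  | tmul f g => simp [sliceRight, mul_comm]

theorem diagonal_apply (t : B.Tensor c) (y : Y) :
    (B.diagonal c t) y = B.eval₂ c t (y, y) := by
  induction t using TensorProduct.induction_on with
  | zero => simp
  | add s t hs ht => simp [hs, ht]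
  | tmul f g => simp [diagonal]

theorem lift_sliceLeft (b : Fin n ⊕ Fin n) (t : B.Tensor c) (y : Y) :
    B.lift c 1 b (B.sliceLeft c y t) = B.sliceLeft c y ((B.lift c 1 b).lTensor _ t) := by
  induction t using TensorProduct.induction_on with
  | zero => simp
  | add s t hs ht => simp [hs, ht]
  | tmul f g => simp [sliceLeft]

theorem lift_sliceRight (a : Fin n ⊕ Fin n) (t : B.Tensor c) (y : Y) :
    B.lift c 0 a (B.sliceRight c y t) = B.sliceRight c y ((B.lift c 0 a).rTensor _ t) := by
  induction t using TensorProduct.induction_on with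
  | zero => simp
  | add s t hs ht => simp [hs, ht]
  | tmul f g => simp [sliceRight]

/-- The chain rule on the diagonal. -/
theorem lift_diagonal (a : Fin n ⊕ Fin n) (t : B.Tensor c) :
    B.lift c 1 a (B.diagonal c t) =
      B.diagonal c ((B.lift c 0 a).rTensor _ t + (B.lift c 1 a).lTensor _ t) := by
  induction t using TensorProduct.induction_on with
  | zero => simp
  | add s t hs ht =>
    simp only [map_add, hs, ht]
    abel
  | tmul f g =>
    refine weightFun_ext fun y hy => ?_
    have h := cdiff_mul (weightFun_mdifferentiableAt f hy) (weightFun_mdifferentiableAt g hy)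
    rw [lift_apply _ _ hy]
    simp only [map_add, LinearMap.rTensor_tmul, LinearMap.lTensor_tmul, add_apply,
      diagonal_apply, eval₂_tmul, lift_apply _ _ hy]
    simp only [frameDeriv]
    have h' := congrArg (fun L => L (B.frame c (some a) y)) h
    simp only [LinearMap.add_apply, LinearMap.smul_apply, smul_eq_mul] at h'
    refine Eq.trans ?_ (h'.trans (by ring))
    rfl

/-- Freezing one variable of a tensor leaves a weight function of the other, on which the derivative
is `lift`. Agreement over the open product region is enough and is preserved, which permits
iteration. -/
theorem frameDeriv_frameDeriv_of_eqOn {Θ : Y × Y → ℂ} {t : B.Tensor c}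
    (h : Set.EqOn Θ (B.eval₂ c t) (B.region c ×ˢ B.region c)) (a b : Fin n ⊕ Fin n) :
    Set.EqOn (tensorOp (B.frameDeriv c (some a)) (B.frameDeriv c (some b)) Θ)
      (B.eval₂ c (TensorProduct.map (B.lift c 0 a) (B.lift c 1 b) t))
      (B.region c ×ˢ B.region c) := by
  rintro ⟨y, y'⟩ ⟨hy, hy'⟩
  have h1 : Set.EqOn (fun y₁ => B.frameDeriv c (some b) (fun y₂ => Θ (y₁, y₂)) y')
      (B.sliceRight c y' ((B.lift c 1 b).lTensor _ t) : Y → ℂ) (B.region c) := by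
    intro y₁ hy₁
    rw [sliceRight_apply, ← sliceLeft_apply, ← lift_sliceLeft, lift_apply _ _ hy']
    refine B.frameDeriv_congr c (fun y₂ hy₂ => ?_) _ hy'
    exact (h ⟨hy₁, hy₂⟩).trans (sliceLeft_apply t y₁ y₂).symm
  have h2 := B.frameDeriv_congr c h1 (some a) hy
  rw [← lift_apply _ _ hy, lift_sliceRight, sliceRight_apply] at h2
  refine h2.trans ?_
  rw [← LinearMap.comp_apply (LinearMap.rTensor _ _), LinearMap.rTensor_comp_lTensor]

theorem poissonSharp_of_eqOn {Θ : Y × Y → ℂ} {t : B.Tensor c}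
    (h : Set.EqOn Θ (B.eval₂ c t) (B.region c ×ˢ B.region c)) :
    Set.EqOn (B.poissonSharp c Θ) (B.eval₂ c (B.poisson c t)) (B.region c ×ˢ B.region c) := by
  intro w hw
  simp only [poisson, LinearMap.sum_apply, LinearMap.sub_apply, map_sum, map_sub,
    Finset.sum_apply, Pi.sub_apply]
  refine Finset.sum_congr rfl fun j _ => ?_
  -- `liftDeriv` along `dp j` and `dq j` unfolds to `frameDeriv` at the indices `inl j` and `inr j`.
  exact congrArg₂ (· - ·) (frameDeriv_frameDeriv_of_eqOn h (.inl j) (.inr j) hw)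
    (frameDeriv_frameDeriv_of_eqOn h (.inr j) (.inl j) hw)

theorem poissonSharp_iterate_of_eqOn {Θ : Y × Y → ℂ} {t : B.Tensor c}
    (h : Set.EqOn Θ (B.eval₂ c t) (B.region c ×ˢ B.region c)) (k : ℕ) :
    Set.EqOn ((B.poissonSharp c)^[k] Θ) (B.eval₂ c ((B.poisson c ^ k) t))
      (B.region c ×ˢ B.region c) := by
  induction k with
  | zero => simpa using h
  | succ k ih =>
    rw [Function.iterate_succ_apply', pow_succ', Module.End.mul_apply]
    exact poissonSharp_of_eqOn ih

/-- On the invariant factor all lifted fields commute, since the curvature term carries the weight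
0. -/
theorem rTensor_mul_poisson (l : Fin n) :
    (B.lift c 0 (.inl l)).rTensor (B.WeightFun c 1) * B.poisson c =
      B.poisson c * (B.lift c 0 (.inl l)).rTensor (B.WeightFun c 1) := by
  simp only [poisson, Finset.mul_sum, Finset.sum_mul]
  refine Finset.sum_congr rfl fun j _ => ?_
  simp only [mul_sub, sub_mul, LinearMap.rTensor, ← TensorProduct.map_mul]
  rw [lift_commute (.inl l) (.inl j), lift_commute (.inl l) (.inr j)]
  rfl

/-- On the second factor `∂_{p_l}^#` fails to commute only with `∂_{q^l}^#`, whose partner in `π^#`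
is `∂_{p_l}^#` on the first factor. The commutator therefore moves the derivative from `Ψ` to `H`.
-/
theorem lTensor_mul_poisson (l : Fin n) :
    (B.lift c 1 (.inl l)).lTensor (B.WeightFun c 0) * B.poisson c =
      B.poisson c * (B.lift c 1 (.inl l)).lTensor (B.WeightFun c 0) +
        (-(Complex.I / ħ)) • (B.lift c 0 (.inl l)).rTensor (B.WeightFun c 1) := by
  -- Written as a sum over `j` so that it can be matched with `π^#` term by term.
  have h : (-(Complex.I / (ħ : ℂ))) • (B.lift c 0 (.inl l)).rTensor (B.WeightFun c 1) =
      ∑ j, (if l = j then -(Complex.I / (ħ : ℂ)) else 0) •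
        (B.lift c 0 (.inl j)).rTensor (B.WeightFun c 1) := by
    simp
  rw [h]
  simp only [poisson, Finset.mul_sum, Finset.sum_mul]
  rw [← Finset.sum_add_distrib]
  refine Finset.sum_congr rfl fun j _ => ?_
  simp only [mul_sub, sub_mul, LinearMap.lTensor, LinearMap.rTensor]
  have hm : ∀ (f f' : Module.End ℂ (B.WeightFun c 0)) (g g' : Module.End ℂ (B.WeightFun c 1)),
      (TensorProduct.map f g * TensorProduct.map f' g' : Module.End ℂ (B.Tensor c)) =
        TensorProduct.map (f * f') (g * g') := fun f f' g g' => (TensorProduct.map_mul f f' g g').symm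
  rw [← Module.End.one_eq_id, ← Module.End.one_eq_id]
  simp only [hm, one_mul, mul_one, lift_inl_inr, lift_inl_inl l j, TensorProduct.map_add_right,
    TensorProduct.map_smul_right]
  abel

end PrequantumBundle

end Weight

/-! ### Limits in `C^∞` -/

section Limit

variable {E F : Type*} [NormedAddCommGroup E] [NormedSpace ℝ E] [NormedAddCommGroup F]
  [NormedSpace ℝ F]

/-- For each `r`, the `r`-th derivatives converge and their derivatives, the curried `(r+1)`-st
ones, converge locally uniformly. Hence the limit of the `r`-th derivatives is differentiable. -/
theorem contDiffOn_of_tendstoLocallyUniformlyOn_iteratedFDeriv {f : ℕ → E → F} {g : E → F}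
    {V : Set E} (hV : IsOpen V) (hf : ∀ N, ContDiffOn ℝ ∞ (f N) V)
    (h : ∀ r : ℕ, TendstoLocallyUniformlyOn (fun N => iteratedFDeriv ℝ r (f N))
      (iteratedFDeriv ℝ r g) atTop V) : ContDiffOn ℝ ∞ g V := by
  refine contDiffOn_of_differentiableOn fun r _ => ?_
  refine DifferentiableOn.congr (f := iteratedFDeriv ℝ r g) (fun x hx => ?_)
    (iteratedFDerivWithin_of_isOpen r hV)
  refine DifferentiableAt.differentiableWithinAt ?_
  let e := continuousMultilinearCurryLeftEquiv ℝ (fun _ : Fin (r + 1) => E) F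
  -- Currying is an isometry, so it preserves locally uniform convergence.
  have h1 := e.lipschitz.uniformContinuous.comp_tendstoLocallyUniformlyOn (h (r + 1))
  refine (hasFDerivAt_of_tendstoLocallyUniformlyOn hV h1 (f := fun N => iteratedFDeriv ℝ r (f N))
    (fun N y hy => ?_) (fun y hy => (h r).tendsto_at hy) hx).differentiableAt
  have hd : DifferentiableAt ℝ (iteratedFDeriv ℝ r (f N)) y :=
    ((hf N).contDiffAt (hV.mem_nhds hy)).differentiableAt_iteratedFDeriv
      (WithTop.coe_lt_coe.2 (ENat.natCast_lt_top r))
  have := hd.hasFDerivAt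
  rw [fderiv_iteratedFDeriv] at this
  exact this

theorem tendsto_of_tendstoLocallyUniformlyOn_iteratedFDeriv {f : ℕ → E → F} {g : E → F}
    {V : Set E} (h : ∀ r : ℕ, TendstoLocallyUniformlyOn (fun N => iteratedFDeriv ℝ r (f N))
      (iteratedFDeriv ℝ r g) atTop V) {x : E} (hx : x ∈ V) :
    Tendsto (fun N => f N x) atTop (𝓝 (g x)) := by
  have h0 := (h 0).tendsto_at hx
  have h1 := ((ContinuousMultilinearMap.apply ℝ (fun _ : Fin 0 => E) F 0).continuous.tendsto _).comp
    h0
  simpa [Function.comp_def] using h1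

theorem tendsto_fderiv_of_tendstoLocallyUniformlyOn_iteratedFDeriv {f : ℕ → E → F} {g : E → F}
    {V : Set E} (h : ∀ r : ℕ, TendstoLocallyUniformlyOn (fun N => iteratedFDeriv ℝ r (f N))
      (iteratedFDeriv ℝ r g) atTop V) {x : E} (hx : x ∈ V) (v : E) :
    Tendsto (fun N => fderiv ℝ (f N) x v) atTop (𝓝 (fderiv ℝ g x v)) := by
  have h0 := (h 1).tendsto_at hx
  have h1 := ((ContinuousMultilinearMap.apply ℝ (fun _ : Fin 1 => E) F
    (fun _ => v)).continuous.tendsto _).comp h0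
  simpa [Function.comp_def] using h1

end Limit

/-- Convergence of derivatives along a curve of points in a product of charts. -/
theorem tendsto_cdiff_of_tendsto_fderiv {m : ℕ} {M : Type*} [TopologicalSpace M]
    [ChartedSpace (EuclideanSpace ℝ (Fin m)) M] {E : Type*} [NormedAddCommGroup E]
    [NormedSpace ℝ E] {x : M} {φ : ℕ → M → ℂ} {ψ : M → ℂ} {f : ℕ → E → ℂ} {g : E → ℂ}
    {j : EuclideanSpace ℝ (Fin m) → E} {j' : EuclideanSpace ℝ (Fin m) →L[ℝ] E}
    (hj : HasFDerivAt j j' (extChartAt (𝓡 m) x x))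
    (hφ : ∀ N, MDifferentiableAt (𝓡 m) 𝓘(ℝ, ℂ) (φ N) x) (hψ : MDifferentiableAt (𝓡 m) 𝓘(ℝ, ℂ) ψ x)
    (hf : ∀ N, DifferentiableAt ℝ (f N) (j (extChartAt (𝓡 m) x x)))
    (hg : DifferentiableAt ℝ g (j (extChartAt (𝓡 m) x x)))
    (hφf : ∀ N, φ N ∘ (extChartAt (𝓡 m) x).symm =ᶠ[𝓝 (extChartAt (𝓡 m) x x)] f N ∘ j)
    (hψg : ψ ∘ (extChartAt (𝓡 m) x).symm =ᶠ[𝓝 (extChartAt (𝓡 m) x x)] g ∘ j)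
    (h : ∀ v, Tendsto (fun N => fderiv ℝ (f N) (j (extChartAt (𝓡 m) x x)) v) atTop
      (𝓝 (fderiv ℝ g (j (extChartAt (𝓡 m) x x)) v))) (ζ : CTangent m x) :
    Tendsto (fun N => cdiff m (φ N) x ζ) atTop (𝓝 (cdiff m ψ x ζ)) := by
  refine tendsto_liftBaseChange (fun v => ?_) ζ
  have key : ∀ {φ : M → ℂ} {f : E → ℂ}, MDifferentiableAt (𝓡 m) 𝓘(ℝ, ℂ) φ x →
      DifferentiableAt ℝ f (j (extChartAt (𝓡 m) x x)) →
      φ ∘ (extChartAt (𝓡 m) x).symm =ᶠ[𝓝 (extChartAt (𝓡 m) x x)] f ∘ j →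
      diff m φ x v = fderiv ℝ f (j (extChartAt (𝓡 m) x x)) (j' v) := by
    intro φ f hφ hf hφf
    rw [diff_eq_fderiv hφ, hφf.fderiv_eq, (hf.hasFDerivAt.comp _ hj).fderiv]
    rfl
  change Tendsto (fun N => diff m (φ N) x v) atTop (𝓝 (diff m ψ x v))
  rw [key hψ hg hψg]
  simp only [key (hφ _) (hf _) (hφf _)]
  exact h _

section Moyal

variable {n : ℕ} {X : Type*} [TopologicalSpace X]
  [ChartedSpace (EuclideanSpace ℝ (Fin (2 * n))) X] [IsManifold (𝓡 (2 * n)) ∞ X]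
  {ħ : ℝ} {Ω : SymplecticForm n X} {Y : Type*} [TopologicalSpace Y]
  [ChartedSpace (EuclideanSpace ℝ (Fin (2 * n + 1))) Y] [IsManifold (𝓡 (2 * n + 1)) ∞ Y]
  [MulAction Circle Y] {B : PrequantumBundle ħ Ω Y}
  {J K : ∀ x : X, Submodule ℂ (CTangent (2 * n) x)} {c : AdaptedChart Ω J K}

namespace PrequantumBundle

/-! ### The formal identity -/

variable (B c) in
/-- The coefficients of the formal Moyal product of a tensor. -/
def moyalCoeff (t : B.Tensor c) (k : ℕ) : B.WeightFun c 1 :=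
  (1 / (k.factorial : ℂ)) • B.diagonal c ((B.poisson c ^ k) t)

theorem coeff_formalMoyal {f g : Y → ℂ} {t : B.Tensor c}
    (h : Set.EqOn (tensorFun f g) (B.eval₂ c t) (B.region c ×ˢ B.region c)) (k : ℕ) {y : Y}
    (hy : y ∈ B.region c) :
    PowerSeries.coeff k (B.formalMoyal c f g y) = B.moyalCoeff c t k y := by
  rw [formalMoyal, PowerSeries.coeff_mk, poissonSharp_iterate_of_eqOn h k ⟨hy, hy⟩, moyalCoeff,
    smul_apply, diagonal_apply]

theorem rTensor_poisson_pow (l : Fin n) (k : ℕ) (t : B.Tensor c) :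
    (B.lift c 0 (.inl l)).rTensor (B.WeightFun c 1) ((B.poisson c ^ k) t) =
      (B.poisson c ^ k) ((B.lift c 0 (.inl l)).rTensor (B.WeightFun c 1) t) := by
  have h : Commute ((B.lift c 0 (.inl l)).rTensor (B.WeightFun c 1) : Module.End ℂ (B.Tensor c))
    (B.poisson c) := rTensor_mul_poisson l
  exact congrArg (fun L => L t) (h.pow_right k).eq

theorem lift_moyalCoeff_zero (l : Fin n) {t : B.Tensor c}
    (ht : (B.lift c 1 (.inl l)).lTensor (B.WeightFun c 0) t = 0) :
    B.lift c 1 (.inl l) (B.moyalCoeff c t 0) =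
      B.moyalCoeff c ((B.lift c 0 (.inl l)).rTensor (B.WeightFun c 1) t) 0 := by
  simp [moyalCoeff, lift_diagonal, ht]

/-- In `∂_{p_l}^# m = m (A + P)`, the `A` part commutes past `π^(k+1)`, and the `P` part leaves only
the commutator term, since `P t = 0`. Its factor `k + 1` turns `1/(k+1)!` into `1/k!`, which gives
the coefficient of index `k`. -/
theorem lift_moyalCoeff_succ (l : Fin n) {t : B.Tensor c}
    (ht : (B.lift c 1 (.inl l)).lTensor (B.WeightFun c 0) t = 0) (k : ℕ) :
    B.lift c 1 (.inl l) (B.moyalCoeff c t (k + 1)) =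
      B.moyalCoeff c ((B.lift c 0 (.inl l)).rTensor (B.WeightFun c 1) t) (k + 1) -
        (Complex.I / ħ) •
          B.moyalCoeff c ((B.lift c 0 (.inl l)).rTensor (B.WeightFun c 1) t) k := by
  have h := congrArg (fun L => L t) (mul_pow_succ_of_commutator
    (R := Module.End ℂ (B.Tensor c)) (rTensor_mul_poisson l) (lTensor_mul_poisson l) k)
  simp only [Module.End.mul_apply, LinearMap.add_apply, LinearMap.smul_apply, ht, map_zero,
    zero_add] at h
  have hk : ((k : ℂ) + 1) ≠ 0 := by exact_mod_cast k.succ_ne_zero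
  have hk' : (k.factorial : ℂ) ≠ 0 := by exact_mod_cast k.factorial_ne_zero
  rw [moyalCoeff, map_smul, lift_diagonal, rTensor_poisson_pow, h, map_add, smul_add, moyalCoeff,
    moyalCoeff, map_smul, smul_smul, smul_smul, sub_eq_add_neg, ← neg_smul]
  congr 2
  rw [Nat.factorial_succ]
  push_cast
  field_simp

theorem formal_identity (l : Fin n) {f f' g : Y → ℂ} {t : B.Tensor c}
    (h : Set.EqOn (tensorFun f g) (B.eval₂ c t) (B.region c ×ˢ B.region c))
    (h' : Set.EqOn (tensorFun f' g)
      (B.eval₂ c ((B.lift c 0 (.inl l)).rTensor (B.WeightFun c 1) t)) (B.region c ×ˢ B.region c))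
    (ht : (B.lift c 1 (.inl l)).lTensor (B.WeightFun c 0) t = 0) {y : Y} (hy : y ∈ B.region c) :
    PowerSeries.mk (fun k => B.liftDeriv (c.dp l)
        (fun y' => PowerSeries.coeff k (B.formalMoyal c f g y')) y) =
      (1 - PowerSeries.C (Complex.I / (ħ : ℂ)) * PowerSeries.X) * B.formalMoyal c f' g y := by
  have hL : ∀ k, B.liftDeriv (c.dp l)
      (fun y' => PowerSeries.coeff k (B.formalMoyal c f g y')) y =
        B.lift c 1 (.inl l) (B.moyalCoeff c t k) y := fun k => by
    rw [lift_apply _ _ hy]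
    exact B.frameDeriv_congr c (fun y' hy' => coeff_formalMoyal h k hy') (some (.inl l)) hy
  ext k
  rw [PowerSeries.coeff_mk, hL, sub_mul, one_mul, mul_assoc, map_sub, PowerSeries.coeff_C_mul,
    coeff_formalMoyal h' k hy]
  cases k with
  | zero => simp [lift_moyalCoeff_zero l ht]
  | succ k =>
    rw [PowerSeries.coeff_succ_X_mul, coeff_formalMoyal h' k hy, lift_moyalCoeff_succ l ht,
      sub_apply, smul_apply]

/-! ### The tensor of an observable and a polarized wave function -/

/-- The tensor is `H ⊗ Ψ`, both factors cut off to the chart. Polarization enters the argument only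
here, as the vanishing of `∂_{p_l}^#` on the second factor. -/
theorem exists_tensor {H : X → ℂ} (hH : ContMDiff (𝓡 (2 * n)) 𝓘(ℝ, ℂ) ∞ H)
    {Ψ : Y → ℂ} (hΨ : B.IsPolarized J Ψ) : ∃ t : B.Tensor c,
    Set.EqOn (tensorFun (H ∘ B.proj) Ψ) (B.eval₂ c t) (B.region c ×ˢ B.region c) ∧
    ∀ l, Set.EqOn (tensorFun (B.liftDeriv (c.dp l) (H ∘ B.proj)) Ψ)
      (B.eval₂ c ((B.lift c 0 (.inl l)).rTensor (B.WeightFun c 1) t))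
      (B.region c ×ˢ B.region c) ∧
    (B.lift c 1 (.inl l)).lTensor (B.WeightFun c 0) t = 0 := by
  let h : B.WeightFun c 0 := ⟨(B.region c).indicator (H ∘ B.proj), indicator_mem_weightSpace
    (fun y _ => (hH.comp B.smooth_proj).contMDiffAt)
    (fun z y _ => by simp [(B.fibre y (z • y)).2 ⟨z, rfl⟩])⟩
  let ψ : B.WeightFun c 1 := ⟨(B.region c).indicator Ψ, indicator_mem_weightSpace
    (fun y _ => hΨ.wave.smooth.contMDiffAt)
    (fun z y _ => by simp [hΨ.wave.equivariant])⟩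
  have hh : Set.EqOn (H ∘ B.proj) h (B.region c) := Set.eqOn_indicator.symm
  have hψ : Set.EqOn Ψ ψ (B.region c) := Set.eqOn_indicator.symm
  refine ⟨h ⊗ₜ ψ, fun w hw => ?_, fun l => ⟨fun w hw => ?_, ?_⟩⟩
  · rw [eval₂_tmul, tensorFun, hh hw.1, hψ hw.2]
  · rw [LinearMap.rTensor_tmul, eval₂_tmul, tensorFun, hψ hw.2, lift_apply _ _ hw.1]
    congr 1
    exact B.frameDeriv_congr c hh (some (.inl l)) hw.1
  · have : B.lift c 1 (.inl l) ψ = 0 := weightFun_ext fun y hy => by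
      rw [lift_apply _ _ hy, ← B.frameDeriv_congr c hψ _ hy, zero_apply]
      refine hΨ.polarized y _ ?_
      rw [c.span_dp _ hy]
      exact Submodule.subset_span ⟨l, rfl⟩
    rw [LinearMap.lTensor_tmul, this, TensorProduct.tmul_zero]

/-! ### Convergence -/

variable (B c) in
/-- The partial sums of the exponential series, as tensors. -/
def tensorSum (t : B.Tensor c) (N : ℕ) : B.Tensor c :=
  ∑ k ∈ Finset.range N, ((1 / (k.factorial : ℂ)) * ((ħ : ℂ) / Complex.I) ^ k) •
    (B.poisson c ^ k) t

theorem expPartialSum_of_eqOn {f g : Y → ℂ} {t : B.Tensor c}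
    (h : Set.EqOn (tensorFun f g) (B.eval₂ c t) (B.region c ×ˢ B.region c)) (N : ℕ) :
    Set.EqOn (B.expPartialSum c f g N) (B.eval₂ c (B.tensorSum c t N))
      (B.region c ×ˢ B.region c) := by
  intro w hw
  simp only [expPartialSum, tensorSum, map_sum, Finset.sum_apply, map_smul, Pi.smul_apply,
    smul_eq_mul]
  exact Finset.sum_congr rfl fun k _ => by rw [poissonSharp_iterate_of_eqOn h k hw]

theorem diagonal_tensorSum (t : B.Tensor c) (N : ℕ) :
    B.diagonal c (B.tensorSum c t N) =
      ∑ k ∈ Finset.range N, ((ħ : ℂ) / Complex.I) ^ k • B.moyalCoeff c t k := by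
  simp only [tensorSum, map_sum, map_smul, moyalCoeff, smul_smul]
  exact Finset.sum_congr rfl fun k _ => by rw [mul_comm]

theorem rTensor_tensorSum (l : Fin n) (t : B.Tensor c) (N : ℕ) :
    (B.lift c 0 (.inl l)).rTensor (B.WeightFun c 1) (B.tensorSum c t N) =
      B.tensorSum c ((B.lift c 0 (.inl l)).rTensor (B.WeightFun c 1) t) N := by
  simp only [tensorSum, map_sum, map_smul, rTensor_poisson_pow]

/-- At `λ = ħ / i` the sum telescopes. -/
theorem lift_diagonal_tensorSum (hħ : ħ ≠ 0) (l : Fin n) {t : B.Tensor c}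
    (ht : (B.lift c 1 (.inl l)).lTensor (B.WeightFun c 0) t = 0) (N : ℕ) :
    B.lift c 1 (.inl l) (B.diagonal c (B.tensorSum c t (N + 1))) =
      B.diagonal c (B.tensorSum c ((B.lift c 0 (.inl l)).rTensor (B.WeightFun c 1) t) (N + 1)) -
        B.diagonal c (B.tensorSum c ((B.lift c 0 (.inl l)).rTensor (B.WeightFun c 1) t) N) := by
  have hħ' : (ħ : ℂ) ≠ 0 := by exact_mod_cast hħ
  -- The difference on the right is the single term of index `N`, which makes the claim accessible
  -- to induction.
  rw [diagonal_tensorSum, diagonal_tensorSum, diagonal_tensorSum,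
    Finset.sum_range_succ_sub_sum]
  induction N with
  | zero => simp [lift_moyalCoeff_zero l ht]
  | succ N ih =>
    rw [Finset.sum_range_succ, map_add, map_smul, lift_moyalCoeff_succ l ht, ih, smul_sub, smul_smul]
    -- The choice `λ = ħ/i` is exactly what makes the commutator term cancel the previous summand.
    have : ((ħ : ℂ) / Complex.I) ^ (N + 1) * (Complex.I / ħ) = ((ħ : ℂ) / Complex.I) ^ N := by
      rw [pow_succ, mul_assoc, div_mul_div_comm, mul_comm Complex.I, div_self, mul_one]
      exact mul_ne_zero hħ' Complex.I_ne_zero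
    rw [this]
    abel

end PrequantumBundle

end Moyal

theorem extChartAt_diagonal_symm_apply {m : ℕ} {M : Type*} [TopologicalSpace M]
    [ChartedSpace (EuclideanSpace ℝ (Fin m)) M] (y : M) (u u' : EuclideanSpace ℝ (Fin m)) :
    (extChartAt ((𝓡 m).prod (𝓡 m)) (y, y)).symm (u, u') =
      ((extChartAt (𝓡 m) y).symm u, (extChartAt (𝓡 m) y).symm u') := by
  rw [extChartAt_prod]
  rfl

theorem extChartAt_diagonal_self {m : ℕ} {M : Type*} [TopologicalSpace M]
    [ChartedSpace (EuclideanSpace ℝ (Fin m)) M] (y : M) :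
    extChartAt ((𝓡 m).prod (𝓡 m)) (y, y) (y, y) =
      (extChartAt (𝓡 m) y y, extChartAt (𝓡 m) y y) := by
  rw [extChartAt_prod]
  rfl

/-! ### Smooth limits near the diagonal and polarization of the product -/

section Product

variable {n : ℕ} {X : Type*} [TopologicalSpace X]
  [ChartedSpace (EuclideanSpace ℝ (Fin (2 * n))) X] [IsManifold (𝓡 (2 * n)) ∞ X]
  {ħ : ℝ} {Ω : SymplecticForm n X} {Y : Type*} [TopologicalSpace Y]
  [ChartedSpace (EuclideanSpace ℝ (Fin (2 * n + 1))) Y] [IsManifold (𝓡 (2 * n + 1)) ∞ Y]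
  [MulAction Circle Y] {B : PrequantumBundle ħ Ω Y}
  {J K : ∀ x : X, Submodule ℂ (CTangent (2 * n) x)} {c : AdaptedChart Ω J K}

namespace PrequantumBundle

variable (B c) in
/-- The part of the preferred chart at `y` lying over the adapted chart. -/
def chartRegion (y : Y) : Set (EuclideanSpace ℝ (Fin (2 * n + 1))) :=
  (extChartAt (𝓡 (2 * n + 1)) y).target ∩
    (extChartAt (𝓡 (2 * n + 1)) y).symm ⁻¹' B.region c

theorem isOpen_chartRegion (y : Y) : IsOpen (B.chartRegion c y) :=
  (contMDiffOn_extChartAt_symm (n := ∞) y).continuousOn.isOpen_inter_preimage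
    (isOpen_extChartAt_target y) (B.isOpen_region c)

theorem mem_chartRegion {y : Y} (hy : y ∈ B.region c) :
    extChartAt (𝓡 (2 * n + 1)) y y ∈ B.chartRegion c y :=
  ⟨mem_extChartAt_target y, by rwa [Set.mem_preimage, extChartAt_to_inv]⟩

theorem contDiffOn_chart_of_weightFun {k : ℕ} (f : B.WeightFun c k) (y : Y) :
    ContDiffOn ℝ ∞ (f ∘ (extChartAt (𝓡 (2 * n + 1)) y).symm) (B.chartRegion c y) :=
  fun _ hu => (contDiffAt_chart hu.1 (f.2.1 _ hu.2)).contDiffWithinAt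

/-- A tensor is a finite sum of products of functions of separate variables, so it is jointly
smooth. -/
theorem contDiffOn_eval₂ (t : B.Tensor c) (y : Y) :
    ContDiffOn ℝ ∞ (B.eval₂ c t ∘ (extChartAt ((𝓡 (2 * n + 1)).prod (𝓡 (2 * n + 1))) (y, y)).symm)
      (B.chartRegion c y ×ˢ B.chartRegion c y) := by
  induction t using TensorProduct.induction_on with
  | zero => simpa using! contDiffOn_const
  | add s t hs ht => simpa using! hs.add ht
  | tmul f g =>
    have h1 := (contDiffOn_chart_of_weightFun f y).comp contDiffOn_fst
      (s := B.chartRegion c y ×ˢ B.chartRegion c y) fun u hu => hu.1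
    have h2 := (contDiffOn_chart_of_weightFun g y).comp contDiffOn_snd
      (s := B.chartRegion c y ×ˢ B.chartRegion c y) fun u hu => hu.2
    refine (h1.mul h2).congr fun u _ => ?_
    rw [Function.comp_apply, extChartAt_diagonal_symm_apply y u.1 u.2]
    rfl

variable {S : ℕ → B.Tensor c} {s : ℕ → Y × Y → ℂ} {E : Y × Y → ℂ} {y : Y}

/-- Near the diagonal, convergence in `C^∞` of functions given by tensors provides a smooth limit
and the convergence of values and of derivatives. -/
theorem smoothLimit_of_tensor (hs : ∀ N, Set.EqOn (s N) (B.eval₂ c (S N)) (B.region c ×ˢ B.region c))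
    (hy : y ∈ B.region c) (hE : TendstoSmoothlyNear (m := 2 * n + 1) s E (y, y)) :
    let e := (extChartAt ((𝓡 (2 * n + 1)).prod (𝓡 (2 * n + 1))) (y, y)).symm
    let w := (extChartAt (𝓡 (2 * n + 1)) y y, extChartAt (𝓡 (2 * n + 1)) y y)
    ContDiffAt ℝ ∞ (E ∘ e) w ∧ (∀ N, ContDiffAt ℝ ∞ (s N ∘ e) w) ∧
      Tendsto (fun N => s N (y, y)) atTop (𝓝 (E (y, y))) ∧
      ∀ v, Tendsto (fun N => fderiv ℝ (s N ∘ e) w v) atTop (𝓝 (fderiv ℝ (E ∘ e) w v)) := by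
  intro e w
  obtain ⟨V, hV, hyV, hlim⟩ := hE
  have hR := mem_chartRegion hy
  have hRo : IsOpen (B.chartRegion c y ×ˢ B.chartRegion c y) :=
    (isOpen_chartRegion y).prod (isOpen_chartRegion y)
  have hV' : IsOpen (V ∩ B.chartRegion c y ×ˢ B.chartRegion c y) := hV.inter hRo
  have hw : w ∈ V ∩ B.chartRegion c y ×ˢ B.chartRegion c y := by
    refine ⟨?_, hR, hR⟩
    rwa [extChartAt_diagonal_self] at hyV
  have hlim' := fun r => (hlim r).mono (Set.inter_subset_left
    (t := B.chartRegion c y ×ˢ B.chartRegion c y))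
  have hf : ∀ N, ContDiffOn ℝ ∞ (s N ∘ e) (V ∩ B.chartRegion c y ×ˢ B.chartRegion c y) := by
    intro N
    refine ((contDiffOn_eval₂ (S N) y).mono Set.inter_subset_right).congr fun u hu => ?_
    refine hs N ?_
    rw [extChartAt_diagonal_symm_apply y u.1 u.2]
    exact ⟨hu.2.1.2, hu.2.2.2⟩
  have hew : e w = (y, y) := by
    rw [extChartAt_diagonal_symm_apply, extChartAt_to_inv]
  refine ⟨(contDiffOn_of_tendstoLocallyUniformlyOn_iteratedFDeriv hV' hf hlim').contDiffAt
    (hV'.mem_nhds hw), fun N => (hf N).contDiffAt (hV'.mem_nhds hw), ?_,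
    tendsto_fderiv_of_tendstoLocallyUniformlyOn_iteratedFDeriv hlim' hw⟩
  have := tendsto_of_tendstoLocallyUniformlyOn_iteratedFDeriv hlim' hw
  change Tendsto (fun N => s N (e w)) atTop (𝓝 (E (e w))) at this
  rwa [hew] at this

theorem eventually_mem_chartRegion (hy : y ∈ B.region c) :
    ∀ᶠ u in 𝓝 (extChartAt (𝓡 (2 * n + 1)) y y), u ∈ B.chartRegion c y :=
  (isOpen_chartRegion y).mem_nhds (mem_chartRegion hy)

theorem contMDiffAt_diagonal_of_tendsto {Φ : Y → ℂ}
    (hs : ∀ N, Set.EqOn (s N) (B.eval₂ c (S N)) (B.region c ×ˢ B.region c))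
    (hy : y ∈ B.region c) (hE : TendstoSmoothlyNear (m := 2 * n + 1) s E (y, y))
    (hΦ : ∀ y' ∈ B.region c, Φ y' = E (y', y')) :
    ContMDiffAt (𝓡 (2 * n + 1)) 𝓘(ℝ, ℂ) ∞ Φ y := by
  refine contMDiffAt_of_contDiffAt_chart ?_
  refine (ContDiffAt.comp (f := fun u => (u, u)) (extChartAt (𝓡 (2 * n + 1)) y y)
    (smoothLimit_of_tensor hs hy hE).1 (contDiffAt_id.prodMk contDiffAt_id)).congr_of_eventuallyEq ?_
  filter_upwards [eventually_mem_chartRegion hy] with u hu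
  exact (hΦ _ hu.2).trans (congrArg E (extChartAt_diagonal_symm_apply y u u).symm)

theorem tendsto_diagonal {Φ : Y → ℂ}
    (hs : ∀ N, Set.EqOn (s N) (B.eval₂ c (S N)) (B.region c ×ˢ B.region c))
    (hy : y ∈ B.region c) (hE : TendstoSmoothlyNear (m := 2 * n + 1) s E (y, y))
    (hΦ : ∀ y' ∈ B.region c, Φ y' = E (y', y')) :
    Tendsto (fun N => B.diagonal c (S N) y) atTop (𝓝 (Φ y)) := by
  rw [hΦ y hy]
  refine (smoothLimit_of_tensor hs hy hE).2.2.1.congr fun N => ?_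
  rw [diagonal_apply, hs N ⟨hy, hy⟩]

theorem tendsto_lift_diagonal {Φ : Y → ℂ}
    (hs : ∀ N, Set.EqOn (s N) (B.eval₂ c (S N)) (B.region c ×ˢ B.region c))
    (hy : y ∈ B.region c) (hE : TendstoSmoothlyNear (m := 2 * n + 1) s E (y, y))
    (hΦ : ∀ y' ∈ B.region c, Φ y' = E (y', y')) (a : Fin n ⊕ Fin n) :
    Tendsto (fun N => B.lift c 1 a (B.diagonal c (S N)) y) atTop
      (𝓝 (B.frameDeriv c (some a) Φ y)) := by
  obtain ⟨h1, h2, -, h4⟩ := smoothLimit_of_tensor hs hy hE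
  simp only [lift_apply _ _ hy]
  refine tendsto_cdiff_of_tendsto_fderiv (j := fun u => (u, u))
    ((hasFDerivAt_id _).prodMk (hasFDerivAt_id _))
    (fun N => weightFun_mdifferentiableAt _ hy)
    ((contMDiffAt_diagonal_of_tendsto hs hy hE hΦ).mdifferentiableAt (by simp))
    (fun N => (h2 N).differentiableAt (by simp)) (h1.differentiableAt (by simp))
    (fun N => ?_) ?_ h4 _
  · filter_upwards [eventually_mem_chartRegion hy] with u hu
    simp only [Function.comp_apply]
    rw [extChartAt_diagonal_symm_apply, diagonal_apply, hs N (Set.mk_mem_prod hu.2 hu.2)]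
  · filter_upwards [eventually_mem_chartRegion hy] with u hu
    simp only [Function.comp_apply]
    rw [extChartAt_diagonal_symm_apply, hΦ _ hu.2]

/-- The limit is the derivative of `E` in its first variable, the second being frozen at `y`. This
uses convergence off the diagonal; only the existence of the limit matters later. -/
theorem exists_tendsto_diagonal_rTensor
    (hs : ∀ N, Set.EqOn (s N) (B.eval₂ c (S N)) (B.region c ×ˢ B.region c))
    (hy : y ∈ B.region c) (hE : TendstoSmoothlyNear (m := 2 * n + 1) s E (y, y))
    (a : Fin n ⊕ Fin n) :
    ∃ L, Tendsto (fun N => B.diagonal c ((B.lift c 0 a).rTensor (B.WeightFun c 1) (S N)) y) atTop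
      (𝓝 L) := by
  obtain ⟨h1, h2, -, h4⟩ := smoothLimit_of_tensor hs hy hE
  refine ⟨B.frameDeriv c (some a) (fun y₁ => E (y₁, y)) y, ?_⟩
  simp only [diagonal_apply, ← sliceRight_apply, ← lift_sliceRight, lift_apply _ _ hy]
  have hj : HasFDerivAt (fun u => (u, extChartAt (𝓡 (2 * n + 1)) y y)) _
      (extChartAt (𝓡 (2 * n + 1)) y y) :=
    (hasFDerivAt_id (𝕜 := ℝ) _).prodMk (hasFDerivAt_const _ _)
  have hEj : (fun y₁ => E (y₁, y)) ∘ (extChartAt (𝓡 (2 * n + 1)) y).symm =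
      (E ∘ (extChartAt ((𝓡 (2 * n + 1)).prod (𝓡 (2 * n + 1))) (y, y)).symm) ∘
        fun u => (u, extChartAt (𝓡 (2 * n + 1)) y y) := by
    funext u
    simp only [Function.comp_apply]
    rw [extChartAt_diagonal_symm_apply, extChartAt_to_inv]
  have hsm : ContMDiffAt (𝓡 (2 * n + 1)) 𝓘(ℝ, ℂ) ∞ (fun y₁ => E (y₁, y)) y := by
    refine contMDiffAt_of_contDiffAt_chart ?_
    rw [hEj]
    exact ContDiffAt.comp (f := fun u => (u, extChartAt (𝓡 (2 * n + 1)) y y))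
      (extChartAt (𝓡 (2 * n + 1)) y y) h1 (contDiffAt_id.prodMk contDiffAt_const)
  refine tendsto_cdiff_of_tendsto_fderiv hj
    (fun N => weightFun_mdifferentiableAt _ hy) (hsm.mdifferentiableAt (by simp))
    (fun N => (h2 N).differentiableAt (by simp)) (h1.differentiableAt (by simp))
    (fun N => ?_) hEj.eventuallyEq h4 _
  filter_upwards [eventually_mem_chartRegion hy] with u hu
  simp only [Function.comp_apply]
  rw [extChartAt_diagonal_symm_apply, extChartAt_to_inv, sliceRight_apply, hs N (Set.mk_mem_prod hu.2 hy)]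

/-- The Moyal quantum product of an observable and a polarized wave function is polarized. -/
theorem isPolarized_of_hasMoyalProduct (hħ : ħ ≠ 0) {H : X → ℂ}
    (hH : ContMDiff (𝓡 (2 * n)) 𝓘(ℝ, ℂ) ∞ H) {Ψ : Y → ℂ} (hΨ : B.IsPolarized J Ψ) {Φ : Y → ℂ}
    (h : B.HasMoyalProduct J K (H ∘ B.proj) Ψ Φ) : B.IsPolarized J Φ := by
  refine ⟨⟨fun y => ?_, fun z y => ?_⟩, fun y => ?_⟩ <;>
    obtain ⟨c, hx, E, hE⟩ := h (B.proj y) <;>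
    obtain ⟨t, ht, ht'⟩ := B.exists_tensor (c := c) hH hΨ <;>
    have hs := expPartialSum_of_eqOn ht <;>
    have hy : y ∈ B.region c := hx <;>
    have hΦ : ∀ y' ∈ B.region c, Φ y' = E (y', y') := fun y' hy' => (hE y' hy').2
  · exact contMDiffAt_diagonal_of_tendsto hs hy (hE y hy).1 hΦ
  · have hzy := (B.smul_mem_region_iff c z y).2 hy
    have h1 := tendsto_diagonal hs hy (hE y hy).1 hΦ
    -- The region is stable under the circle, so the same chart and sums serve `y` and `z • y`;
    -- every partial sum on the diagonal has weight 1.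
    refine tendsto_nhds_unique (tendsto_diagonal hs hzy (hE _ hzy).1 hΦ)
      ((h1.const_mul (z : ℂ)).congr fun N => ?_)
    rw [(B.diagonal c _).2.2.1 z y, pow_one]
  · have hl : ∀ l, B.frameDeriv c (some (.inl l)) Φ y = 0 := by
      intro l
      obtain ⟨L, hL⟩ := exists_tendsto_diagonal_rTensor hs hy (hE y hy).1 (.inl l)
      simp only [rTensor_tensorSum] at hL
      -- The shift to `N + 1` gives the telescoped form: a difference of consecutive terms of a
      -- convergent sequence, which tends to zero.
      have h1 := (tendsto_add_atTop_iff_nat 1).2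
        (tendsto_lift_diagonal hs hy (hE y hy).1 hΦ (.inl l))
      simp only [lift_diagonal_tensorSum hħ l (ht' l).2, sub_apply] at h1
      refine tendsto_nhds_unique h1 ?_
      simpa using ((tendsto_add_atTop_iff_nat 1).2 hL).sub hL
    intro ζ hζ
    rw [c.span_dp _ hx] at hζ
    have hle : Submodule.span ℂ (Set.range fun j => c.dp j (B.proj y)) ≤
        LinearMap.ker (cdiff (2 * n + 1) Φ y ∘ₗ B.chlift y) := by
      rw [Submodule.span_le]
      rintro _ ⟨l, rfl⟩
      exact hl l
    exact hle hζ

end PrequantumBundle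

end Product

end FlatQuant

end

open FlatQuant in
theorem mainTheorem2 {n : ℕ}
    {X : Type*} [TopologicalSpace X] [ChartedSpace (EuclideanSpace ℝ (Fin (2 * n))) X]
    [IsManifold (𝓡 (2 * n)) ∞ X]
    {Y : Type*} [TopologicalSpace Y] [ChartedSpace (EuclideanSpace ℝ (Fin (2 * n + 1))) Y]
    [IsManifold (𝓡 (2 * n + 1)) ∞ Y] [MulAction Circle Y]
    (ħ : ℝ) (hħ : 0 < ħ) (Ω : SymplecticForm n X) (B : PrequantumBundle ħ Ω Y)
    (J K : ∀ x : X, Submodule ℂ (CTangent (2 * n) x)) (hflat : IsFlatBiPolarized Ω J K)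
    (H : X → ℂ) (hH : ContMDiff (𝓡 (2 * n)) 𝓘(ℝ, ℂ) ∞ H)
    (Ψ : Y → ℂ) (hΨ : B.IsPolarized J Ψ) :
    (∀ (c : AdaptedChart Ω J K) (l : Fin n) (y : Y), B.proj y ∈ c.U →
      PowerSeries.mk (fun k => B.liftDeriv (c.dp l)
        (fun y' => PowerSeries.coeff k (B.formalMoyal c (H ∘ B.proj) Ψ y')) y) =
      (1 - PowerSeries.C (Complex.I / (ħ : ℂ)) * PowerSeries.X) *
        B.formalMoyal c (B.liftDeriv (c.dp l) (H ∘ B.proj)) Ψ y) ∧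
    ∀ Φ : Y → ℂ, B.HasMoyalProduct J K (H ∘ B.proj) Ψ Φ → B.IsPolarized J Φ := by
  refine ⟨fun c l y hy => ?_, fun Φ hΦ => B.isPolarized_of_hasMoyalProduct hħ.ne' hH hΨ hΦ⟩
  obtain ⟨t, ht, ht'⟩ := B.exists_tensor (c := c) hH hΨ
  exact PrequantumBundle.formal_identity l ht (ht' l).1 (ht' l).2 hy
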